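/- Let $2\mathrm{SAT}$ be the Boolean constraint language $\{R\oplus b : b\in\{0,1\}^2\}$, where $R=\{(x_1,x_2)\in\{0,1\}^2 : x_1+x_2\in\{1,2\}\}$ is the binary disjunction. A clause over $2\mathrm{SAT}$ is a pair consisting of a scope $(v_1,v_2)$ of (not necessarily distinct) variables and a relation in $2\mathrm{SAT}$; an assignment $\alpha$ satisfies it if $(\alpha(v_1),\alpha(v_2))$ belongs to the relation. For an instance $I=(V,\mathcal C)$, with finite set of variables $V$ and finite collection of clauses $\mathcal C$, and $\alpha:V\to\{0,1\}$, let $\mathcal C_I(\alpha)\subseteq\mathcal C$ be the collection of clauses satisfied by $\alpha$. The problem ImproveMaxCSP(2SAT), parameterized by $k$, is the following search problem. The input is an instance $I=(V,\mathcal C)$ over $2\mathrm{SAT}$, a number $k\in\mathbb N$ and a subcollection $\mathcal P\subseteq\mathcal C$, with the promise that some assignment $\alpha_0$ satisfies $|\mathcal C_I(\alpha_0)\,\Delta\,\mathcal P|\le k$. The task is to output an assignment $\alpha:V\to\{0,1\}$ such that $|\mathcal C_I(\alpha)|\ge|\mathcal C_I(\alpha_0)|$ for every $\alpha_0$ with $|\mathcal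 C_I(\alpha_0)\,\Delta\,\mathcal P|\le k$ (any assignment is accepted if the promise fails). **Theorem.** ImproveMaxCSP(2SAT) is W[1]-hard, both when clauses may be repeated in $\mathcal C$ and when $\mathcal C$ is required to be a set of pairwise distinct clauses. Here W[1] is the class of parameterized problems $L\subseteq\{0,1\}^*\times\mathbb N$ that have, for some constant $d$, a parameterized reduction to the problem of deciding, given a Boolean circuit of weft at most $1$ and depth at most $d$ and a number $k$ (the parameter), whether the circuit has a satisfying assignment with exactly $k$ inputs set to true. A search problem is W[1]-hard if every $L$ in W[1] reduces to it: there are a map, computable in time $f(k)\,|(x,k)|^{O(1)}$ with $f$ computable, from inputs $(x,k)$ of $L$ to instances of the search problem that have a correct answer and whose parameter is bounded by a computable function of $k$, and a procedure, running in time $f'(k)\,n^{O(1)}$ with $f'$ computable, where $n$ is the total length of its input, that decides whether $(x,k)\in L$ from $(x,k)$ and any correct answer to the instance produced. -/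

import Mathlib

namespace ParamCSP

/-! ## Data, programs and their running time

Inputs and outputs of programs are binary trees (S-expressions).  Programs form the usual
structured WHILE language over such trees, in combinator form.  Every evaluation step is charged
the size of the tree it is applied to, so that the cost of a run bounds the size of every
intermediate value and the model is polynomially equivalent to multi-tape Turing machines. -/

/-- Binary trees. -/
inductive Data where
  | nil : Data
  | cons : Data → Data → Data

namespace Data

/-- The number of nodes of a tree (leaves included). -/
def size : Data → ℕ
  | nil => 1
  | cons a b => a.size + b.size + 1

/-- First component (`nil` at `nil`). -/
def head : Data → Data
  | nil => nil
  | cons a _ => a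

/-- Second component (`nil` at `nil`). -/
def tail : Data → Data
  | nil => nil
  | cons _ b => b

/-- Lists of trees as trees. -/
def ofList : List Data → Data
  | [] => nil
  | a :: l => cons a (ofList l)

/-- Natural numbers in unary. -/
def ofNat : ℕ → Data
  | 0 => nil
  | n + 1 => cons nil (ofNat n)

/-- Truth values. -/
def ofBool : Bool → Data
  | false => nil
  | true => cons nil nil

end Data

/-- Programs; each one transforms a tree into a tree. -/
inductive Prog where
  /-- return the input -/
  | id : Prog
  /-- return `nil` -/
  | nil : Prog
  /-- return the first component of the input -/
  | head : Prog
  /-- return the second component of the input -/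
  | tail : Prog
  /-- run both programs on the input and return the pair of their results -/
  | pair : Prog → Prog → Prog
  /-- `seq p q`: run `p`, then run `q` on the result -/
  | seq : Prog → Prog → Prog
  /-- `ite c p q`: run `p` if the result of `c` is not `nil`, otherwise run `q` -/
  | ite : Prog → Prog → Prog → Prog
  /-- `loop c p`: as long as the result of `c` on the current value is not `nil`,
  replace the current value by the result of `p` -/
  | loop : Prog → Prog → Prog

/-- `Run p x y t`: the program `p` on input `x` halts with output `y` at cost `t`. -/
inductive Run : Prog → Data → Data → ℕ → Prop where
  | id (x : Data) : Run .id x x x.size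
  | nil (x : Data) : Run .nil x .nil x.size
  | head (x : Data) : Run .head x x.head x.size
  | tail (x : Data) : Run .tail x x.tail x.size
  | pair {p q : Prog} {x y z : Data} {s t : ℕ} :
      Run p x y s → Run q x z t → Run (.pair p q) x (.cons y z) (s + t + x.size)
  | seq {p q : Prog} {x y z : Data} {s t : ℕ} :
      Run p x y s → Run q y z t → Run (.seq p q) x z (s + t + x.size)
  | ite_true {c p q : Prog} {x b y : Data} {s t : ℕ} :
      Run c x b s → b ≠ .nil → Run p x y t → Run (.ite c p q) x y (s + t + x.size)
  | ite_false {c p q : Prog} {x y : Data} {s t : ℕ} :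
      Run c x .nil s → Run q x y t → Run (.ite c p q) x y (s + t + x.size)
  | loop_stop {c p : Prog} {x : Data} {s : ℕ} :
      Run c x .nil s → Run (.loop c p) x x (s + x.size)
  | loop_step {c p : Prog} {x b y z : Data} {s t u : ℕ} :
      Run c x b s → b ≠ .nil → Run p x y t → Run (.loop c p) y z u →
        Run (.loop c p) x z (s + t + u + x.size)

/-- A single program takes each `inp i` to `out i` within time `f (κ i) * |inp i| ^ c`, for a
computable function `f` and a constant `c`. -/
def FptComputable {ι : Type} (inp : ι → Data) (κ : ι → ℕ) (out : ι → Data) : Prop :=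
  ∃ (p : Prog) (f : ℕ → ℕ) (c : ℕ), Computable f ∧
    ∀ i, ∃ t, t ≤ f (κ i) * (inp i).size ^ c ∧ Run p (inp i) (out i) t

/-! ## The class W[1] -/

/-- A gate whose predecessors are among the gates `0, …, n - 1`. -/
inductive Gate (n : ℕ) where
  | input : Gate n
  | not : Fin n → Gate n
  | and : List (Fin n) → Gate n
  | or : List (Fin n) → Gate n

namespace Gate

/-- The predecessors of a gate. -/
def preds {n : ℕ} : Gate n → List (Fin n)
  | input => []
  | not a => [a]
  | and l => l
  | or l => l

/-- A gate is large if its fan-in exceeds two. -/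
def IsLarge {n : ℕ} (g : Gate n) : Prop := 2 < g.preds.length

instance {n : ℕ} (g : Gate n) : Decidable g.IsLarge :=
  inferInstanceAs (Decidable (2 < g.preds.length))

/-- Encoding of a gate. -/
def enc {n : ℕ} : Gate n → Data
  | input => .cons (.ofNat 0) .nil
  | not a => .cons (.ofNat 1) (.ofNat a)
  | and l => .cons (.ofNat 2) (.ofList (l.map fun a => .ofNat a))
  | or l => .cons (.ofNat 3) (.ofList (l.map fun a => .ofNat a))

end Gate

/-- A Boolean circuit: an acyclic network of gates, listed in topological order, with a
designated output gate. -/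
structure Circuit where
  size : ℕ
  gate : (i : Fin size) → Gate i
  out : Fin size

namespace Circuit

/-- The value of gate `i` when exactly the input gates in `T` are set to true. -/
def val (C : Circuit) (T : Finset (Fin C.size)) (i : Fin C.size) : Bool :=
  match C.gate i with
  | .input => decide (i ∈ T)
  | .not a => !(C.val T ⟨a, a.2.trans i.2⟩)
  | .and l => l.all fun a => C.val T ⟨a, a.2.trans i.2⟩
  | .or l => l.any fun a => C.val T ⟨a, a.2.trans i.2⟩
termination_by i.1
decreasing_by all_goals exact a.2

/-- The maximal number of edges on a path that ends in gate `i`. -/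
def depthAt (C : Circuit) (i : Fin C.size) : ℕ :=
  ((C.gate i).preds.map fun (a : Fin i.1) => C.depthAt ⟨a, a.2.trans i.2⟩ + 1).foldr max 0
termination_by i.1
decreasing_by all_goals exact a.2

/-- The maximal number of large gates on a path that ends in gate `i`. -/
def weftAt (C : Circuit) (i : Fin C.size) : ℕ :=
  ((C.gate i).preds.map fun (a : Fin i.1) => C.weftAt ⟨a, a.2.trans i.2⟩).foldr max 0 +
    if (C.gate i).IsLarge then 1 else 0
termination_by i.1
decreasing_by all_goals exact a.2

/-- The depth of a circuit. -/
def depth (C : Circuit) : ℕ := C.depthAt C.out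

/-- The weft of a circuit. -/
def weft (C : Circuit) : ℕ := C.weftAt C.out

/-- The circuit has a satisfying assignment of weight exactly `k`. -/
def HasWeightedSat (C : Circuit) (k : ℕ) : Prop :=
  ∃ T : Finset (Fin C.size), (∀ i ∈ T, C.gate i = .input) ∧ T.card = k ∧ C.val T C.out = true

/-- Encoding of a circuit. -/
def enc (C : Circuit) : Data :=
  .cons (.ofList (List.ofFn fun i => (C.gate i).enc)) (.ofNat C.out)

end Circuit

/-- A parameterized (decision) problem: a set of pairs of a binary word and a parameter. -/
abbrev ParamLanguage := Set (List Bool × ℕ)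

/-- Encoding of a binary word together with a parameter. -/
def encInput (x : List Bool × ℕ) : Data :=
  .cons (.ofList (x.1.map Data.ofBool)) (.ofNat x.2)

/-- The class W[t]: the parameterized problems with a parameterized reduction to the weighted
satisfiability problem for circuits of weft at most `t` and depth at most `d`, for some
constant `d`. -/
def InW (t : ℕ) (L : ParamLanguage) : Prop :=
  ∃ (d : ℕ) (F : List Bool × ℕ → Circuit × ℕ) (g : ℕ → ℕ),
    FptComputable encInput (fun x => x.2) (fun x => .cons (F x).1.enc (.ofNat (F x).2)) ∧
    Computable g ∧
    ∀ x, (F x).1.weft ≤ t ∧ (F x).1.depth ≤ d ∧ (F x).2 ≤ g x.2 ∧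
      (x ∈ L ↔ (F x).1.HasWeightedSat (F x).2)

/-! ## Hardness of parameterized search problems -/

/-- A parameterized search problem: encoded instances with a parameter, encoded answers to each
instance, and the relation which tells the correct answers to an instance. -/
structure ParamSearchProblem where
  Inst : Type
  Ans : Inst → Type
  encInst : Inst → Data
  encAns : (I : Inst) → Ans I → Data
  param : Inst → ℕ
  Correct : (I : Inst) → Ans I → Prop

/-- The restriction of a search problem to a class of instances. -/
def ParamSearchProblem.restrict (Q : ParamSearchProblem) (D : Q.Inst → Prop) :
    ParamSearchProblem where
  Inst := {I : Q.Inst // D I}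
  Ans I := Q.Ans I.1
  encInst I := Q.encInst I.1
  encAns I := Q.encAns I.1
  param I := Q.param I.1
  Correct I := Q.Correct I.1

open Classical in
/-- A parameterized reduction of a decision problem `L` to a search problem `Q`: an fpt-time map
`F` from inputs of `L` to (solvable) instances of `Q` whose parameter is bounded by a computable
function of the old one, and an fpt-time procedure that decides whether `x ∈ L` from `x` and any
correct answer to the instance `F x`. -/
def ReducesToSearch (L : ParamLanguage) (Q : ParamSearchProblem) : Prop :=
  ∃ (F : List Bool × ℕ → Q.Inst) (g : ℕ → ℕ),
    FptComputable encInput (fun x => x.2) (fun x => Q.encInst (F x)) ∧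
    Computable g ∧ (∀ x, Q.param (F x) ≤ g x.2) ∧
    (∀ x, ∃ y, Q.Correct (F x) y) ∧
    FptComputable (ι := (x : List Bool × ℕ) × {y : Q.Ans (F x) // Q.Correct (F x) y})
      (fun i => .cons (encInput i.1) (Q.encAns (F i.1) i.2.1)) (fun i => i.1.2)
      (fun i => .ofBool (decide (i.1 ∈ L)))

/-- A search problem is W[1]-hard if every problem in W[1] reduces to it. -/
def IsW1Hard (Q : ParamSearchProblem) : Prop :=
  ∀ L : ParamLanguage, InW 1 L → ReducesToSearch L Q

/-! ## Constraint satisfaction problems -/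

/-- Boolean relations of arity `r`. -/
abbrev BoolRel (r : ℕ) := Set (Fin r → Bool)

/-- The symmetric relation of all tuples whose number of ones lies in `S`. -/
def symRel (r : ℕ) (S : Set ℕ) : BoolRel r :=
  {t | (Finset.univ.filter fun i => t i = true).card ∈ S}

/-- The relation `R ⊕ b`. -/
def BoolRel.shift {r : ℕ} (R : BoolRel r) (b : Fin r → Bool) : BoolRel r :=
  (fun t i => xor (t i) (b i)) '' R

/-- The symmetric language with negation given by `r` and `S`. -/
def symLangN (r : ℕ) (S : Set ℕ) : Set (BoolRel r) :=
  {R | ∃ b : Fin r → Bool, R = (symRel r S).shift b}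

/-- A CSP instance over a language `Γ` of relations of arity `r`.  The variables and the clauses
are numbered; clause `j` has scope `scope j` and relation `rel j`. -/
structure CSPInstance {r : ℕ} (Γ : Set (BoolRel r)) where
  numVars : ℕ
  numClauses : ℕ
  scope : Fin numClauses → Fin r → Fin numVars
  rel : Fin numClauses → BoolRel r
  rel_mem : ∀ j, rel j ∈ Γ

namespace CSPInstance

variable {r : ℕ} {Γ : Set (BoolRel r)}

/-- No clause, as a pair of a scope and a relation, is repeated. -/
def IsSimple (I : CSPInstance Γ) : Prop :=
  Function.Injective fun j => (I.scope j, I.rel j)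

open Classical in
/-- The set of (indices of) clauses that an assignment satisfies. -/
noncomputable def satisfied (I : CSPInstance Γ) (α : Fin I.numVars → Bool) :
    Finset (Fin I.numClauses) :=
  Finset.univ.filter fun j => (fun i => α (I.scope j i)) ∈ I.rel j

end CSPInstance

/-- An input of the problem ImproveMaxCSP over `Γ`. -/
structure ImproveInstance {r : ℕ} (Γ : Set (BoolRel r)) where
  csp : CSPInstance Γ
  k : ℕ
  P : Finset (Fin csp.numClauses)

open Classical in
/-- Encoding of a relation by its truth table; the `i`-th entry of the tuple in row `m` is the
`i`-th binary digit of `m`. -/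
noncomputable def BoolRel.enc {r : ℕ} (R : BoolRel r) : Data :=
  .ofList (List.ofFn fun m : Fin (2 ^ r) =>
    .ofBool (decide ((fun i : Fin r => m.1.testBit i.1) ∈ R)))

/-- Encoding of an input: the number of variables, the list of clauses, each given by its scope,
its relation and the bit that tells whether it lies in `P`, and the number `k`. -/
noncomputable def ImproveInstance.enc {r : ℕ} {Γ : Set (BoolRel r)} (J : ImproveInstance Γ) :
    Data :=
  .cons (.ofNat J.csp.numVars)
    (.cons
      (.ofList (List.ofFn fun j =>
        .cons (.ofList (List.ofFn fun i => .ofNat (J.csp.scope j i)))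
          (.cons (J.csp.rel j).enc (.ofBool (decide (j ∈ J.P))))))
      (.ofNat J.k))

/-- The problem ImproveMaxCSP over `Γ`, with parameter `k`: find an assignment that satisfies at
least as many clauses as any assignment `α₀` for which the set of satisfied clauses differs from
`P` in at most `k` clauses.  (If there is no such `α₀`, the promise fails and every assignment is
a correct answer.) -/
noncomputable def improveMaxCSP {r : ℕ} (Γ : Set (BoolRel r)) : ParamSearchProblem where
  Inst := ImproveInstance Γ
  Ans J := Fin J.csp.numVars → Bool
  encInst J := J.enc
  encAns _ α := .ofList (List.ofFn fun v => .ofBool (α v))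
  param J := J.k
  Correct J α := ∀ α₀ : Fin J.csp.numVars → Bool,
    (symmDiff (J.csp.satisfied α₀) J.P).card ≤ J.k →
      (J.csp.satisfied α₀).card ≤ (J.csp.satisfied α).card

/-- The language 2SAT: all relations `R ⊕ b`, where `R` is the binary disjunction. -/
def twoSAT : Set (BoolRel 2) := symLangN 2 {1, 2}

end ParamCSP

namespace ParamCSP

/-! ## Polynomial-time functions -/

/-! The reduction leads from a circuit of weft one to an independent set problem in a conflict
graph, and from there to clauses.

Clauses: for a graph, let `P` consist of the clauses "not both `i` and `j`", one for each ordered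
pair of adjacent vertices, and add outside `P` the clause "`i` or `i`" for every vertex. An
independent set of size `N` satisfies all of `P` and `N` further clauses, so it lies at distance `N`
from `P`. An arbitrary assignment satisfies `|P| - clash + gain` clauses, where `clash` counts
violated clauses of `P` and `gain` counts true vertices. If `gain - clash` is at least `N`, deleting
one endpoint per violated clause leaves an independent set of size at least `N`. Hence any correct
answer reveals by counting whether such a set exists (`test_iff`).

Circuits: for a fixed depth bound `d`, the output is true iff all conditions "gate `a` has value
`b`" in one of polynomially many lists `e` hold, where every gate `a` has weft zero
(`Circuit.val_iff_certs`, `Circuit.certs_wf`). Such a gate depends on at most `q = 2 ^ d` inputs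
(`Circuit.length_ins`).

Views: a choice of `k` true inputs is an injection `τ` from the positions below `k` to inputs. A
slot names up to `q` positions. A view of it consists of a list `e`, inputs for these positions, and
a partial injection `R` extending them whose inputs alone satisfy all of `e`. It suffices to take
`R` from a bounded search: if `R` violates a condition that holds for `τ`, then one of at most `q`
inputs is missing from `R`. This gives `(k * q) ^ k` extensions for each start. Views conflict if
their lists differ, their slots agree, or their injections are incompatible. An independent set of
size `(k + 1) ^ q` has one view for each slot, and these glue to some `τ`. For a condition `c` of
`e`, at most `q` positions carry inputs below `c`. The view whose slot names them has `R` inside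
`τ`, and `R` and `τ` agree on the inputs of `c`; as `c` holds for `R`, it holds for `τ`
(`exists_independent`, `exists_solution`).

Running time: `Poly` is closed under the usual list operations, which covers everything except the
enumeration of the `(k * q) ^ k` search sequences. That one takes time depending on `k` only
(`exists_run_words`). -/

lemma eval_nat_mono (P : Polynomial ℕ) : Monotone fun n => P.eval n := by
  intro m n h
  induction P using Polynomial.induction_on' with
  | add p q hp hq => simpa using add_le_add hp hq
  | monomial i a => simpa using Nat.mul_le_mul_left a (Nat.pow_le_pow_left h i)

lemma exists_eval_le_mul_pow (P : Polynomial ℕ) :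
    ∃ c : ℕ, ∀ n, 1 ≤ n → P.eval n ≤ c * n ^ c := by
  induction P using Polynomial.induction_on' with
  | add p q hp hq =>
    obtain ⟨c, hc⟩ := hp
    obtain ⟨d, hd⟩ := hq
    refine ⟨c + d, fun n hn => ?_⟩
    have h1 := hc n hn
    have h2 := hd n hn
    have h3 : n ^ c ≤ n ^ (c + d) := Nat.pow_le_pow_right hn (by omega)
    have h4 : n ^ d ≤ n ^ (c + d) := Nat.pow_le_pow_right hn (by omega)
    rw [Polynomial.eval_add]
    nlinarith [Nat.mul_le_mul_left c h3, Nat.mul_le_mul_left d h4]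
  | monomial i a =>
    refine ⟨a + i, fun n hn => ?_⟩
    rw [Polynomial.eval_monomial]
    exact Nat.mul_le_mul (by omega) (Nat.pow_le_pow_right hn (by omega))

lemma Data.one_le_size (x : Data) : 1 ≤ x.size := by
  cases x <;> simp [Data.size]

/-- Every step is charged the size of its input, so time bounds output size. This is what keeps
compositions and loops within a time bound. -/
lemma Run.size_le {p : Prog} {x y : Data} {t : ℕ} (h : Run p x y t) : y.size ≤ t := by
  induction h with
  | id x => exact le_rfl
  | nil x => exact x.one_le_size
  | head x => cases x <;> simp [Data.head, Data.size]; omega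
  | tail x => cases x <;> simp [Data.tail, Data.size]; omega
  | @pair p q x y z s t _ _ h1 h2 =>
    have := x.one_le_size
    simp only [Data.size]; omega
  | seq => omega
  | ite_true => omega
  | ite_false => omega
  | loop_stop => omega
  | loop_step => omega

/-- Types whose elements are encoded by trees. -/
class Enc (α : Type) where
  enc : α → Data

open Enc

instance : Enc Data := ⟨fun x => x⟩
instance : Enc ℕ := ⟨Data.ofNat⟩
instance : Enc Bool := ⟨Data.ofBool⟩
instance {α β : Type} [Enc α] [Enc β] : Enc (α × β) := ⟨fun x => .cons (enc x.1) (enc x.2)⟩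
instance {α : Type} [Enc α] : Enc (List α) := ⟨fun l => .ofList (l.map enc)⟩

/-- The length of the encoding. -/
def esize {α : Type} [Enc α] (a : α) : ℕ := (enc a).size

section Enc
variable {α β : Type} [Enc α] [Enc β]

@[simp] lemma enc_data (a : Data) : enc a = a := rfl
@[simp] lemma enc_zero : enc (0 : ℕ) = .nil := rfl
@[simp] lemma enc_succ (n : ℕ) : enc (n + 1) = .cons .nil (enc n) := rfl
@[simp] lemma enc_false : enc false = .nil := rfl
@[simp] lemma enc_true : enc true = .cons .nil .nil := rfl
@[simp] lemma enc_prod (a : α) (b : β) : enc (a, b) = .cons (enc a) (enc b) := rfl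
@[simp] lemma enc_list_nil : enc ([] : List α) = .nil := rfl
@[simp] lemma enc_list_cons (a : α) (l : List α) : enc (a :: l) = .cons (enc a) (enc l) := rfl

@[simp] lemma esize_prod (a : α) (b : β) : esize (a, b) = esize a + esize b + 1 := rfl
@[simp] lemma esize_list_nil : esize ([] : List α) = 1 := rfl
@[simp] lemma esize_list_cons (a : α) (l : List α) : esize (a :: l) = esize a + esize l + 1 := rfl
@[simp] lemma esize_zero : esize (0 : ℕ) = 1 := rfl
@[simp] lemma esize_succ (n : ℕ) : esize (n + 1) = esize n + 2 := by
  simp [esize, Data.size]; omega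

lemma one_le_esize (a : α) : 1 ≤ esize a := Data.one_le_size _

lemma length_lt_esize (l : List α) : l.length < esize l := by
  induction l with
  | nil => simp
  | cons a l ih => simp; omega

lemma esize_le_of_mem {l : List α} {a : α} (h : a ∈ l) : esize a ≤ esize l := by
  induction l with
  | nil => simp at h
  | cons b l ih =>
    rcases List.mem_cons.1 h with rfl | h
    · simp; omega
    · have := ih h
      simp; omega

lemma esize_append (l l' : List α) : esize (l ++ l') + 1 = esize l + esize l' := by
  induction l with
  | nil => simp; omega
  | cons a l ih => simp; omega

end Enc

/-- Functions between encoded types that a program computes in polynomial time. -/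
@[fun_prop]
def Poly {α β : Type} [Enc α] [Enc β] (f : α → β) : Prop :=
  ∃ (p : Prog) (P : Polynomial ℕ), ∀ a, ∃ t, t ≤ P.eval (esize a) ∧ Run p (enc a) (enc (f a)) t

namespace Poly
variable {α β γ δ ε : Type} [Enc α] [Enc β] [Enc γ] [Enc δ] [Enc ε]

/-- Functions that leave the encoding unchanged. -/
theorem of_enc_eq {f : α → β} (h : ∀ a, enc (f a) = enc a) : Poly f :=
  ⟨.id, Polynomial.X, fun a => ⟨esize a, by simp, by rw [h]; exact .id _⟩⟩

@[fun_prop]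
theorem id : Poly (fun a : α => a) := of_enc_eq fun _ => rfl

@[fun_prop]
theorem comp {g : β → γ} {f : α → β} (hg : Poly g) (hf : Poly f) : Poly (fun a => g (f a)) := by
  obtain ⟨p, P, hp⟩ := hf
  obtain ⟨q, Q, hq⟩ := hg
  refine ⟨.seq p q, P + Q.comp P + Polynomial.X, fun a => ?_⟩
  obtain ⟨s, hs, hs'⟩ := hp a
  obtain ⟨t, ht, ht'⟩ := hq (f a)
  refine ⟨_, ?_, .seq hs' ht'⟩
  have h1 : esize (f a) ≤ P.eval (esize a) := hs'.size_le.trans hs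
  have h2 := eval_nat_mono Q h1
  simp only [Polynomial.eval_add, Polynomial.eval_comp, Polynomial.eval_X]
  have h3 : (enc a).size = esize a := rfl
  dsimp only at h2
  omega

theorem output_size {f : α → β} (hf : Poly f) :
    ∃ P : Polynomial ℕ, ∀ a, esize (f a) ≤ P.eval (esize a) := by
  obtain ⟨p, P, hp⟩ := hf
  refine ⟨P, fun a => ?_⟩
  obtain ⟨t, ht, hr⟩ := hp a
  exact hr.size_le.trans ht

@[fun_prop]
theorem pair {f : α → β} {g : α → γ} (hf : Poly f) (hg : Poly g) : Poly (fun a => (f a, g a)) := by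
  obtain ⟨p, P, hp⟩ := hf
  obtain ⟨q, Q, hq⟩ := hg
  refine ⟨.pair p q, P + Q + Polynomial.X, fun a => ?_⟩
  obtain ⟨s, hs, hs'⟩ := hp a
  obtain ⟨t, ht, ht'⟩ := hq a
  refine ⟨_, ?_, .pair hs' ht'⟩
  simp only [Polynomial.eval_add, Polynomial.eval_X]
  exact add_le_add (add_le_add hs ht) le_rfl

theorem const_nil (f : α → β) (h : ∀ a, enc (f a) = .nil) : Poly f :=
  ⟨.nil, Polynomial.X, fun a => ⟨esize a, by simp, by rw [h]; exact .nil _⟩⟩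

theorem const_data (d : Data) : Poly (fun _ : α => d) := by
  induction d with
  | nil => exact const_nil _ fun _ => rfl
  | cons x y hx hy =>
    exact comp (g := fun z : Data × Data => Data.cons z.1 z.2) (of_enc_eq fun _ => rfl) (hx.pair hy)

@[fun_prop]
theorem const (b : β) : Poly (fun _ : α => b) := const_data (enc b)

@[fun_prop]
theorem fst {f : α → β × γ} (hf : Poly f) : Poly (fun a => (f a).1) :=
  comp (g := Prod.fst) ⟨.head, Polynomial.X, fun a => ⟨esize a, by simp, .head _⟩⟩ hf

@[fun_prop]
theorem snd {f : α → β × γ} (hf : Poly f) : Poly (fun a => (f a).2) :=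
  comp (g := Prod.snd) ⟨.tail, Polynomial.X, fun a => ⟨esize a, by simp, .tail _⟩⟩ hf

@[fun_prop]
theorem cons {f : α → β} {g : α → List β} (hf : Poly f) (hg : Poly g) :
    Poly (fun a => f a :: g a) :=
  comp (g := fun x : β × List β => x.1 :: x.2) (of_enc_eq fun _ => rfl) (hf.pair hg)

@[fun_prop]
theorem succ {f : α → ℕ} (hf : Poly f) : Poly (fun a => f a + 1) :=
  comp (g := fun x : Data × ℕ => x.2 + 1)
    ⟨.pair .nil .tail, 3 * Polynomial.X, fun a => ⟨_, by
      simp only [Polynomial.eval_mul, Polynomial.eval_X, Polynomial.eval_ofNat, esize]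
      exact le_of_eq (by ring), .pair (.nil _) (.tail _)⟩⟩ ((const Data.nil).pair hf)

@[fun_prop]
theorem ite {p : α → Prop} [∀ a, Decidable (p a)] {f g : α → β} (hp : Poly fun a => decide (p a))
    (hf : Poly f) (hg : Poly g) : Poly (fun a => if p a then f a else g a) := by
  obtain ⟨c, C, hc⟩ := hp
  obtain ⟨p, P, hp⟩ := hf
  obtain ⟨q, Q, hq⟩ := hg
  refine ⟨.ite c p q, C + P + Q + Polynomial.X, fun a => ?_⟩
  obtain ⟨r, hr, hr'⟩ := hc a
  obtain ⟨s, hs, hs'⟩ := hp a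
  obtain ⟨t, ht, ht'⟩ := hq a
  have h3 : (enc a).size = esize a := rfl
  simp only [Polynomial.eval_add, Polynomial.eval_X]
  split_ifs with h
  · refine ⟨_, ?_, .ite_true hr' (by simp [h]) hs'⟩
    omega
  · simp only [h, decide_false, enc_false] at hr'
    refine ⟨_, ?_, .ite_false hr' ht'⟩
    omega

/-- The loop state is the triple of environment, remaining list and accumulator. The condition reads
the remaining list; the body drops its first entry and applies `p` to environment, accumulator and
that entry. States have size at most `M`, so a round costs `Q.eval M` for `p` and at most `40 * M`
for the rearrangement. -/
lemma run_loop_foldl {p : Prog} {Q : Polynomial ℕ} {f : ε → β → α → β}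
    (hp : ∀ e b a, ∃ t, t ≤ Q.eval (esize (e, b, a)) ∧
      Run p (enc (e, b, a)) (enc (f e b a)) t) (e : ε) (M : ℕ) (l : List α) (b : β)
    (hM : ∀ l', l' <+: l → esize (e, l, l'.foldl (f e) b) ≤ M) :
    ∃ t, t ≤ (l.length + 1) * (Q.eval M + 40 * M) ∧
      Run (.loop (.seq .tail .head) (.pair .head (.pair (.seq .tail (.seq .head .tail))
        (.seq (.pair .head (.pair (.seq .tail .tail) (.seq .tail (.seq .head .head)))) p))))
        (enc (e, l, b)) (enc (e, ([] : List α), l.foldl (f e) b)) t := by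
  induction l generalizing b with
  | nil =>
    refine ⟨_, ?_, Run.loop_stop (.seq (.tail _) (.head _))⟩
    have hM := hM [] (List.prefix_refl _)
    simp only [Data.tail, enc_prod, enc_list_nil, Data.size]
    simp only [esize_prod, esize_list_nil, List.foldl_nil] at hM
    simp only [esize] at hM
    simp only [List.length_nil, zero_add, one_mul]
    omega
  | cons a l ih =>
    obtain ⟨s, hs, hs'⟩ := hp e b a
    have hM0 := hM [] List.nil_prefix
    simp only [esize_prod, esize_list_cons, List.foldl_nil] at hM0 hs
    obtain ⟨t, ht, ht'⟩ := ih (f e b a) (fun l' h => by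
      have := hM (a :: l') (by simpa using h)
      simp only [esize_prod, esize_list_cons, List.foldl_cons] at this ⊢
      omega)
    rw [List.foldl_cons]
    refine ⟨_, ?_, .loop_step (.seq (.tail _) (.head _)) (by simp [Data.tail, Data.head])
      (.pair (.head _) (.pair (.seq (.tail _) (.seq (.head _) (.tail _)))
        (.seq (.pair (.head _) (.pair (.seq (.tail _) (.tail _))
          (.seq (.tail _) (.seq (.head _) (.head _))))) hs'))) ht'⟩
    have h1 : s ≤ Q.eval M := hs.trans (eval_nat_mono Q (by omega))
    simp only [Data.tail, Data.head, enc_prod, enc_list_cons, Data.size, List.length_cons]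
    simp only [esize] at hM0
    have h3 : (l.length + 1 + 1) * (Q.eval M + 40 * M) =
      (l.length + 1) * (Q.eval M + 40 * M) + Q.eval M + 40 * M := by ring
    rw [h3]
    omega

/-- Iteration along a list, when all intermediate states are polynomially bounded. -/
theorem foldl_of_bounded {f : γ → β → α → β} {l : γ → List α} {b : γ → β}
    (hf : Poly (fun x : γ × β × α => f x.1 x.2.1 x.2.2)) (hl : Poly l) (hb : Poly b)
    (hP : ∃ P : Polynomial ℕ, ∀ c l', l' <+: l c →
      esize (l'.foldl (f c) (b c)) ≤ P.eval (esize c)) :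
    Poly (fun c => (l c).foldl (f c) (b c)) := by
  obtain ⟨P, hP⟩ := hP
  obtain ⟨p, Q, hp⟩ := hf
  obtain ⟨r, R, hr⟩ := id.pair (hl.pair hb)
  let S : Polynomial ℕ := R * (Q.comp (R + P) + 40 * (R + P))
  refine ⟨.seq r (.seq (.loop (.seq .tail .head) (.pair .head (.pair (.seq .tail
    (.seq .head .tail)) (.seq (.pair .head (.pair (.seq .tail .tail)
      (.seq .tail (.seq .head .head)))) p)))) (.seq .tail .tail)),
    R + S + 4 * S + R + Polynomial.X, fun c => ?_⟩
  obtain ⟨s, hs, hs'⟩ := hr c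
  set n := esize c with hn
  have hN : esize (c, l c, b c) ≤ R.eval n := hs'.size_le.trans hs
  obtain ⟨t, ht, ht'⟩ := run_loop_foldl (fun e b a => hp (e, b, a)) c ((R + P).eval n) (l c) (b c)
    (fun l' h => by
      have h1 : esize (l'.foldl (f c) (b c)) ≤ P.eval n := hP c l' h
      change esize (c, l c, l'.foldl (f c) (b c)) ≤ _
      simp only [esize_prod, Polynomial.eval_add] at *
      omega)
  refine ⟨_, ?_, .seq hs' (.seq ht' (.seq (.tail _) (.tail _)))⟩
  have h1 : t ≤ S.eval n := by
    refine ht.trans ?_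
    have := length_lt_esize (l c)
    simp only [S, Polynomial.eval_add, Polynomial.eval_mul, Polynomial.eval_comp,
      Polynomial.eval_ofNat]
    refine Nat.mul_le_mul_right _ ?_
    simp only [esize_prod] at hN
    omega
  have h2 := ht'.size_le
  have h3 : (enc c).size = n := rfl
  have h4 : (enc (c, l c, b c)).size ≤ R.eval n := hN
  simp only [Polynomial.eval_add, Polynomial.eval_mul, Polynomial.eval_X, Polynomial.eval_ofNat, h3]
  simp only [enc_prod, Data.tail, Data.size] at h2 h4 ⊢
  omega

/-- Iteration along a list, where each step enlarges the state by a polynomially bounded amount. -/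
theorem foldl {f : γ → β → α → β} {l : γ → List α} {b : γ → β}
    (hf : Poly (fun x : γ × β × α => f x.1 x.2.1 x.2.2)) (hl : Poly l) (hb : Poly b)
    (hg : ∃ P : Polynomial ℕ, ∀ e b a, esize (f e b a) ≤ esize b + P.eval (esize (e, a))) :
    Poly (fun c => (l c).foldl (f c) (b c)) := by
  obtain ⟨P, hP⟩ := hg
  obtain ⟨R, hR⟩ := output_size hl
  obtain ⟨S, hS⟩ := output_size hb
  refine foldl_of_bounded hf hl hb ⟨S + R * P.comp (Polynomial.X + R + 1), fun c l' h => ?_⟩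
  have h0 : l'.length ≤ R.eval (esize c) :=
    h.length_le.trans ((length_lt_esize _).le.trans (hR c))
  have h1 : ∀ (l' : List α) (b : β), (∀ a ∈ l', a ∈ l c) → esize (l'.foldl (f c) b) ≤
      esize b + l'.length * P.eval (esize c + R.eval (esize c) + 1) := by
    intro l'
    induction l' with
    | nil => simp
    | cons a l' ih =>
      intro b h
      refine (ih _ fun a ha => h a (by simp [ha])).trans ?_
      have h2 : esize (f c b a) ≤ esize b + P.eval (esize c + R.eval (esize c) + 1) := by
        refine (hP c b a).trans (Nat.add_le_add_left (eval_nat_mono P ?_) _)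
        have := (esize_le_of_mem (h a (by simp))).trans (hR c)
        simp only [esize_prod]
        omega
      simp only [List.length_cons, Nat.add_mul, one_mul]
      omega
  refine (h1 l' (b c) fun a ha => h.subset ha).trans ?_
  simp only [Polynomial.eval_add, Polynomial.eval_mul, Polynomial.eval_comp, Polynomial.eval_X,
    Polynomial.eval_one]
  exact add_le_add (hS c) (Nat.mul_le_mul_right _ h0)

/-- The bound `M` on the states is arbitrary, so this serves polynomial-time loops as well as
iterations bounded only in terms of the parameter. -/
lemma run_loop_iterate {c : α → Bool} {f : α → α} {p q : Prog} {P Q : Polynomial ℕ}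
    (hp : ∀ a, ∃ t, t ≤ P.eval (esize a) ∧ Run p (enc a) (enc (c a)) t)
    (hq : ∀ a, ∃ t, t ≤ Q.eval (esize a) ∧ Run q (enc a) (enc (f a)) t) (M m : ℕ) (a : α)
    (h1 : ∀ j < m, c (f^[j] a) = true) (h2 : c (f^[m] a) = false)
    (h3 : ∀ j ≤ m, esize (f^[j] a) ≤ M) :
    ∃ t, t ≤ (m + 1) * (P.eval M + Q.eval M + M) ∧
      Run (.loop p q) (enc a) (enc (f^[m] a)) t := by
  induction m generalizing a with
  | zero =>
    obtain ⟨t, ht, ht'⟩ := hp a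
    have h4 : (enc a).size ≤ M := h3 0 le_rfl
    have h5 := eval_nat_mono P h4
    simp only [Function.iterate_zero_apply] at h2
    rw [h2] at ht'
    refine ⟨_, ?_, Run.loop_stop ht'⟩
    simp only [esize] at ht h5
    omega
  | succ m ih =>
    obtain ⟨s, hs, hs'⟩ := hp a
    obtain ⟨t, ht, ht'⟩ := hq a
    obtain ⟨u, hu, hu'⟩ := ih (f a) (fun j hj => h1 (j + 1) (by omega)) h2
      (fun j hj => h3 (j + 1) (by omega))
    have h4 : (enc a).size ≤ M := h3 0 (by omega)
    have h5 := eval_nat_mono P h4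
    have h6 := eval_nat_mono Q h4
    have h7 := h1 0 (by omega)
    simp only [Function.iterate_zero_apply] at h7
    refine ⟨_, ?_, .loop_step hs' (by simp [h7]) ht' hu'⟩
    simp only [esize] at ht h5 h6 hs
    rw [Nat.add_mul]
    omega

/-- Repetition as long as a condition holds, with polynomially many polynomially bounded states. -/
theorem loop {c : α → Bool} {f g : α → α} (hc : Poly c) (hf : Poly f) (R : Polynomial ℕ)
    (h : ∀ a, ∃ m, m ≤ R.eval (esize a) ∧ (∀ j < m, c (f^[j] a) = true) ∧ c (f^[m] a) = false ∧
      g a = f^[m] a ∧ ∀ j ≤ m, esize (f^[j] a) ≤ R.eval (esize a)) : Poly g := by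
  obtain ⟨p, P, hp⟩ := hc
  obtain ⟨q, Q, hq⟩ := hf
  refine ⟨.loop p q, (R + 1) * (P.comp R + Q.comp R + R), fun a => ?_⟩
  obtain ⟨m, hm, h1, h2, h3, h4⟩ := h a
  obtain ⟨t, ht, ht'⟩ := run_loop_iterate hp hq _ m a h1 h2 h4
  refine ⟨t, ht.trans ?_, h3 ▸ ht'⟩
  simp only [Polynomial.eval_add, Polynomial.eval_mul, Polynomial.eval_comp, Polynomial.eval_one]
  exact Nat.mul_le_mul_right _ (by omega)

end Poly

/-! ### Lists, arithmetic and Boolean operations in polynomial time -/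

namespace Poly
variable {α β γ δ ε : Type} [Enc α] [Enc β] [Enc γ] [Enc δ] [Enc ε]

theorem reverse_map {f : γ → α → β} {l : γ → List α} (hf : Poly fun x : γ × α => f x.1 x.2)
    (hl : Poly l) : Poly (fun c => ((l c).map (f c)).reverse) := by
  have h : Poly (fun c => (l c).foldl (fun acc a => f c a :: acc) []) := by
    refine foldl (f := fun c acc a => f c a :: acc) (b := fun _ => []) ?_ hl (const _) ?_
    · have : Poly fun x : γ × List β × α => f (x.1, x.2.2).1 (x.1, x.2.2).2 :=
        comp (g := fun x : γ × α => f x.1 x.2) hf (by fun_prop)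
      fun_prop
    · obtain ⟨P, hP⟩ := output_size hf
      refine ⟨P + 1, fun e b a => ?_⟩
      have : esize (f e a) ≤ _ := hP (e, a)
      simp only [esize_list_cons, Polynomial.eval_add, Polynomial.eval_one]
      omega
  convert h using 2 with c
  have : ∀ (l : List α) (acc : List β),
      l.foldl (fun acc a => f c a :: acc) acc = (l.map (f c)).reverse ++ acc := by
    intro l
    induction l with
    | nil => simp
    | cons a l ih => simp [ih]
  simp [this]

@[fun_prop]
theorem reverse {l : γ → List α} (hl : Poly l) : Poly (fun c => (l c).reverse) := by
  simpa using reverse_map (f := fun _ a => a) (by fun_prop) hl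

@[fun_prop]
theorem map {f : γ → α → β} {l : γ → List α} (hf : Poly fun x : γ × α => f x.1 x.2)
    (hl : Poly l) : Poly (fun c => (l c).map (f c)) := by
  simpa using reverse (reverse_map hf hl)

@[fun_prop]
theorem append {l l' : γ → List α} (hl : Poly l) (hl' : Poly l') : Poly (fun c => l c ++ l' c) := by
  have h : Poly (fun c => (l c).reverse.foldl (fun acc a => a :: acc) (l' c)) := by
    refine foldl (f := fun _ acc a => a :: acc) (by fun_prop) (by fun_prop) hl' ?_
    refine ⟨Polynomial.X, fun e b a => ?_⟩
    simp only [esize_list_cons, esize_prod, Polynomial.eval_X]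
    omega
  simpa using h

@[fun_prop]
theorem flatten {l : γ → List (List α)} (hl : Poly l) : Poly (fun c => (l c).flatten) := by
  have h : Poly (fun c => (l c).foldl (fun acc a => acc ++ a) []) := by
    refine foldl (f := fun _ acc a => acc ++ a) (by fun_prop) hl (const _) ?_
    refine ⟨Polynomial.X, fun e b a => ?_⟩
    have := esize_append b a
    simp only [esize_prod, Polynomial.eval_X]
    omega
  convert h using 2 with c
  have : ∀ (l : List (List α)) (acc : List α),
      l.foldl (fun acc a => acc ++ a) acc = acc ++ l.flatten := by
    intro l
    induction l with
    | nil => simp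
    | cons a l ih => simp [ih]
  simp [this]

@[fun_prop]
theorem flatMap {f : γ → α → List β} {l : γ → List α} (hf : Poly fun x : γ × α => f x.1 x.2)
    (hl : Poly l) : Poly (fun c => (l c).flatMap (f c)) := by
  simpa [List.flatMap_def] using flatten (map hf hl)

@[fun_prop]
theorem filter {f : γ → α → Bool} {l : γ → List α} (hf : Poly fun x : γ × α => f x.1 x.2)
    (hl : Poly l) : Poly (fun c => (l c).filter (f c)) := by
  have h : Poly (fun c => (l c).flatMap fun a => if f c a = true then [a] else []) := by
    refine flatMap (f := fun c a => if f c a = true then [a] else []) ?_ hl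
    refine ite ?_ (by fun_prop) (by fun_prop)
    simpa using hf
  convert h using 2 with c
  induction l c with
  | nil => rfl
  | cons a l ih =>
    rw [List.filter_cons, List.flatMap_cons, ih]
    split_ifs <;> simp

@[fun_prop]
theorem length {l : γ → List α} (hl : Poly l) : Poly (fun c => (l c).length) := by
  have h : Poly (fun c => (l c).foldl (fun acc _ => acc + 1) 0) := by
    refine foldl (f := fun _ acc _ => acc + 1) (by fun_prop) hl (const _) ?_
    refine ⟨2, fun e b a => ?_⟩
    simp
  simpa using h

-- A unary number and a list of that many `nil`s are the same tree. Arithmetic thereby reduces to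
-- list operations.
@[fun_prop]
theorem replicate {n : γ → ℕ} (hn : Poly n) : Poly (fun c => List.replicate (n c) Data.nil) := by
  refine comp (g := fun n => List.replicate n Data.nil) (of_enc_eq fun n => ?_) hn
  induction n with
  | zero => rfl
  | succ n ih => simp [List.replicate_succ, ih]

lemma esize_nat (n : ℕ) : esize n = 2 * n + 1 := by
  induction n with
  | zero => rfl
  | succ n ih => rw [esize_succ]; omega

lemma esize_list_le {l : List α} {M : ℕ} (h : ∀ a ∈ l, esize a ≤ M) :
    esize l ≤ l.length * (M + 1) + 1 := by
  induction l with
  | nil => simp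
  | cons a l ih =>
    have h1 := ih fun a ha => h a (by simp [ha])
    have h2 := h a (by simp)
    simp only [esize_list_cons, List.length_cons, Nat.add_mul]
    omega

@[fun_prop]
theorem range {n : γ → ℕ} (hn : Poly n) : Poly (fun c => List.range (n c)) := by
  have h0 : ∀ l : List Data, l.foldl (fun (acc : ℕ × List ℕ) _ => (acc.1 + 1, acc.1 :: acc.2)) (0, [])
      = (l.length, (List.range l.length).reverse) := by
    intro l
    induction l using List.reverseRecOn with
    | nil => rfl
    | append_singleton l a ih => simp [ih, List.range_succ]
  have h : Poly (fun c => (List.replicate (n c) Data.nil).foldl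
      (fun (acc : ℕ × List ℕ) _ => (acc.1 + 1, acc.1 :: acc.2)) (0, [])) := by
    obtain ⟨P, hP⟩ := output_size hn
    -- A step copies the counter, which belongs to the state, so its growth is not bounded by
    -- environment and entry alone and `foldl` does not apply.
    refine foldl_of_bounded (f := fun _ (acc : ℕ × List ℕ) _ => (acc.1 + 1, acc.1 :: acc.2))
      (by fun_prop) (by fun_prop) (const _) ⟨P + P * (P + 1) + 2, fun c l' h => ?_⟩
    rw [h0]
    have h1 := h.length_le
    simp only [List.length_replicate] at h1
    have h2 := hP c
    rw [esize_nat] at h2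
    have h3 : esize (List.range l'.length).reverse ≤
        (List.range l'.length).reverse.length * (P.eval (esize c) + 1) + 1 := by
      refine esize_list_le fun a ha => ?_
      simp only [List.mem_reverse, List.mem_range] at ha
      rw [esize_nat]
      omega
    simp only [List.length_reverse, List.length_range] at h3
    simp only [esize_prod, esize_nat, Polynomial.eval_add, Polynomial.eval_mul,
      Polynomial.eval_one, Polynomial.eval_ofNat]
    have h4 : l'.length * (P.eval (esize c) + 1) ≤ P.eval (esize c) * (P.eval (esize c) + 1) :=
      Nat.mul_le_mul_right _ (by omega)
    omega
  simpa [h0] using reverse (snd h)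

@[fun_prop]
theorem decide_eq_nil {l : γ → List α} [∀ c, Decidable (l c = [])] (hl : Poly l) :
    Poly (fun c => decide (l c = [])) := by
  have h : Poly (fun c => (l c).foldl (fun _ _ => false) true) :=
    foldl (f := fun _ _ _ => false) (by fun_prop) hl (const _)
      ⟨0, fun e b a => by simpa [esize, Data.size] using one_le_esize b⟩
  convert h using 2 with c
  rw [Bool.eq_iff_iff, decide_eq_true_eq]
  rcases l c with _ | ⟨a, l⟩
  · simp
  · have : ∀ l : List α, l.foldl (fun _ _ => false) false = false := by
      intro l
      induction l with
      | nil => rfl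
      | cons a l ih => exact ih
    simp [this]

@[fun_prop]
theorem tail {l : γ → List α} (hl : Poly l) : Poly (fun c => (l c).tail) := by
  refine comp (g := List.tail) ⟨.tail, Polynomial.X, fun a => ⟨esize a, by simp, ?_⟩⟩ hl
  cases a <;> exact .tail _

@[fun_prop]
theorem headD {l : γ → List α} {d : γ → α} (hl : Poly l) (hd : Poly d) :
    Poly (fun c => (l c).headD (d c)) := by
  have h : Poly (fun c => (l c).reverse.foldl (fun _ a => a) (d c)) :=
    foldl (f := fun _ _ a => a) (by fun_prop) (by fun_prop) hd
      ⟨Polynomial.X, fun e b a => by simp; omega⟩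
  convert h using 2 with c
  cases l c <;> simp

@[fun_prop]
theorem drop {n : γ → ℕ} {l : γ → List α} (hn : Poly n) (hl : Poly l) :
    Poly (fun c => (l c).drop (n c)) := by
  have h : Poly (fun c => (List.replicate (n c) Data.nil).foldl (fun l _ => l.tail) (l c)) :=
    foldl (f := fun _ l _ => l.tail) (by fun_prop) (by fun_prop) hl
      ⟨0, fun e b a => by cases b <;> simp; omega⟩
  convert h using 2 with c
  generalize l c = l
  induction n c generalizing l with
  | zero => rfl
  | succ n ih => rw [List.replicate_succ, List.foldl_cons, ← ih]; simp

@[fun_prop]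
theorem getD {l : γ → List α} {n : γ → ℕ} {d : γ → α} (hl : Poly l) (hn : Poly n) (hd : Poly d) :
    Poly (fun c => (l c).getD (n c) (d c)) := by
  have h : Poly (fun c => ((l c).drop (n c)).headD (d c)) := by fun_prop
  convert h using 2 with c
  simp [List.headD_eq_head?_getD, List.head?_drop]

@[fun_prop]
theorem decide_le {m n : γ → ℕ} [∀ c, Decidable (m c ≤ n c)] (hm : Poly m) (hn : Poly n) :
    Poly (fun c => decide (m c ≤ n c)) := by
  have h : Poly (fun c => decide ((List.replicate (m c) Data.nil).drop (n c) = [])) := by fun_prop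
  convert h using 3 with c
  simp [Nat.sub_eq_zero_iff_le]

@[fun_prop]
theorem decide_lt {m n : γ → ℕ} [∀ c, Decidable (m c < n c)] (hm : Poly m) (hn : Poly n) :
    Poly (fun c => decide (m c < n c)) := by
  have h : Poly (fun c => decide (m c + 1 ≤ n c)) := by fun_prop
  convert h using 3 with c
  exact Nat.lt_iff_add_one_le

@[fun_prop]
theorem add {m n : γ → ℕ} (hm : Poly m) (hn : Poly n) : Poly (fun c => m c + n c) := by
  have h : Poly (fun c => (List.replicate (m c) Data.nil ++ List.replicate (n c) Data.nil).length) := by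
    fun_prop
  simpa using h

@[fun_prop]
theorem decide_eq_true {b : γ → Bool} [∀ c, Decidable (b c = true)] (hb : Poly b) :
    Poly (fun c => decide (b c = true)) := by
  simpa using hb

@[fun_prop]
theorem and {a b : γ → Bool} (ha : Poly a) (hb : Poly b) : Poly (fun c => a c && b c) := by
  have h : Poly (fun c => if a c = true then b c else false) := by fun_prop
  convert h using 2 with c
  cases a c <;> simp

@[fun_prop]
theorem or {a b : γ → Bool} (ha : Poly a) (hb : Poly b) : Poly (fun c => a c || b c) := by
  have h : Poly (fun c => if a c = true then true else b c) := by fun_prop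
  convert h using 2 with c
  cases a c <;> simp

@[fun_prop]
theorem not {a : γ → Bool} (ha : Poly a) : Poly (fun c => !a c) := by
  have h : Poly (fun c => if a c = true then false else true) := by fun_prop
  convert h using 2 with c
  cases a c <;> simp

@[fun_prop]
theorem all {f : γ → α → Bool} {l : γ → List α} (hf : Poly fun x : γ × α => f x.1 x.2)
    (hl : Poly l) : Poly (fun c => (l c).all (f c)) := by
  have h : Poly (fun c => decide ((l c).filter (fun a => !f c a) = [])) := by fun_prop
  convert h using 2 with c
  rw [Bool.eq_iff_iff]
  simp

@[fun_prop]
theorem any {f : γ → α → Bool} {l : γ → List α} (hf : Poly fun x : γ × α => f x.1 x.2)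
    (hl : Poly l) : Poly (fun c => (l c).any (f c)) := by
  have h : Poly (fun c => !(l c).all (fun a => !f c a)) := by fun_prop
  convert h using 2 with c
  rw [Bool.eq_iff_iff]
  simp

@[fun_prop]
theorem data_head {f : γ → Data} (hf : Poly f) : Poly (fun c => (f c).head) :=
  comp (g := Data.head) ⟨.head, Polynomial.X, fun a => ⟨esize a, by simp, .head _⟩⟩ hf

@[fun_prop]
theorem data_tail {f : γ → Data} (hf : Poly f) : Poly (fun c => (f c).tail) :=
  comp (g := Data.tail) ⟨.tail, Polynomial.X, fun a => ⟨esize a, by simp, .tail _⟩⟩ hf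

end Poly

/-! ### Equality tests for encoded objects -/

/-- The list whose encoding is a given tree. -/
def Data.toList : Data → List Data
  | .nil => []
  | .cons a b => a :: b.toList

lemma enc_toList (d : Data) : enc d.toList = d := by
  induction d with
  | nil => rfl
  | cons a b _ hb => rw [Data.toList, enc_list_cons, hb]; rfl

lemma toList_enc {α : Type} [Enc α] (l : List α) : (enc l).toList = l.map enc := by
  induction l with
  | nil => rfl
  | cons a l ih => simp [Data.toList, ih]

/-- One step of the comparison of two trees: the state is a list of pairs that still have to be
compared, and the result so far. -/
def eqStep (s : List (Data × Data) × Bool) : List (Data × Data) × Bool :=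
  let x := (s.1.headD (.nil, .nil)).1
  let y := (s.1.headD (.nil, .nil)).2
  if x.toList = [] then (s.1.tail, s.2 && decide (y.toList = []))
  else if y.toList = [] then (s.1.tail, false)
  else ((x.head, y.head) :: (x.tail, y.tail) :: s.1.tail, s.2)

/-- Splitting a pair of inner nodes into two pairs of subtrees preserves the size of the list; all
other steps drop a pair or leave the empty list as it is. -/
lemma eqStep_esize (s : List (Data × Data) × Bool) : esize (eqStep s).1 ≤ esize s.1 := by
  obtain ⟨_ | ⟨⟨x, y⟩, l⟩, b⟩ := s
  · simp [eqStep, Data.toList]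
  · rcases x with _ | ⟨x, x'⟩
    · simp [eqStep, Data.toList]; omega
    · rcases y with _ | ⟨y, y'⟩
      · simp [eqStep, Data.toList]; omega
      · simp [eqStep, Data.toList, Data.head, Data.tail]
        simp [esize, Data.size]
        omega

/-- The total size of the first components. -/
def pendingSize (l : List (Data × Data)) : ℕ := (l.map fun x => x.1.size).sum

lemma eqStep_pending (s : List (Data × Data) × Bool) (h : s.1 ≠ []) :
    pendingSize (eqStep s).1 < pendingSize s.1 := by
  obtain ⟨_ | ⟨⟨x, y⟩, l⟩, b⟩ := s
  · simp at h
  · rcases x with _ | ⟨x, x'⟩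
    · simp [eqStep, Data.toList, pendingSize, Data.size]
    · rcases y with _ | ⟨y, y'⟩
      · simp [eqStep, Data.toList, pendingSize, Data.size]
      · simp [eqStep, Data.toList, pendingSize, Data.size, Data.head, Data.tail]
        omega

/-- The invariant of the comparison: once no pairs are pending, the flag alone is the answer. -/
lemma eqStep_result (s : List (Data × Data) × Bool) :
    ((eqStep s).2 = true ∧ ∀ p ∈ (eqStep s).1, p.1 = p.2) ↔ (s.2 = true ∧ ∀ p ∈ s.1, p.1 = p.2) := by
  obtain ⟨_ | ⟨⟨x, y⟩, l⟩, b⟩ := s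
  · simp [eqStep, Data.toList]
  · rcases x with _ | ⟨x, x'⟩ <;> rcases y with _ | ⟨y, y'⟩ <;>
      simp [eqStep, Data.toList, Data.head, Data.tail, and_assoc]

lemma eqStep_iterate (n : ℕ) (s : List (Data × Data) × Bool) (h : pendingSize s.1 ≤ n) :
    (eqStep^[n] s).2 = true ↔ (s.2 = true ∧ ∀ p ∈ s.1, p.1 = p.2) := by
  induction n generalizing s with
  | zero =>
    obtain ⟨_ | ⟨⟨x, y⟩, l⟩, b⟩ := s
    · simp
    · have := x.one_le_size
      simp [pendingSize] at h
      omega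
  | succ n ih =>
    rw [Function.iterate_succ_apply, ih, eqStep_result]
    by_cases h0 : s.1 = []
    · obtain ⟨l, b⟩ := s
      subst h0
      simp [eqStep, Data.toList, pendingSize]
    · have := eqStep_pending s h0
      omega

/-- Needed only to write `decide (x = y)` as a function; the program computing it comes from
`decide_data_eq`. -/
noncomputable instance : DecidableEq Data := Classical.decEq _

/-- Encodings that determine the encoded object. -/
class LawfulEnc (α : Type) [Enc α] : Prop where
  inj : Function.Injective (enc : α → Data)

instance : LawfulEnc Data := ⟨fun _ _ h => h⟩
instance : LawfulEnc ℕ := ⟨fun m n h => by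
  have : esize m = esize n := by rw [esize, esize, h]
  rw [Poly.esize_nat, Poly.esize_nat] at this
  omega⟩
instance : LawfulEnc Bool := ⟨fun a b h => by cases a <;> cases b <;> simp_all⟩
instance {α β : Type} [Enc α] [Enc β] [LawfulEnc α] [LawfulEnc β] : LawfulEnc (α × β) :=
  ⟨fun ⟨a, b⟩ ⟨c, d⟩ h => by
    simp only [enc_prod, Data.cons.injEq] at h
    rw [LawfulEnc.inj h.1, LawfulEnc.inj h.2]⟩
instance {α : Type} [Enc α] [LawfulEnc α] : LawfulEnc (List α) :=
  ⟨fun a b h => by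
    have := congrArg Data.toList h
    rw [toList_enc, toList_enc] at this
    exact (List.map_injective_iff.2 LawfulEnc.inj) this⟩

namespace Poly
variable {α β γ δ ε : Type} [Enc α] [Enc β] [Enc γ] [Enc δ] [Enc ε]

@[fun_prop]
theorem toList {f : γ → Data} (hf : Poly f) : Poly (fun c => (f c).toList) :=
  comp (g := Data.toList) (of_enc_eq enc_toList) hf

/-- Programs have no recursion, so the comparison runs on an explicit list of pending pairs. The
list never grows, and the nodes pending on the left decrease in every round. -/
theorem decide_data_eq {f g : γ → Data} (hf : Poly f) (hg : Poly g) :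
    Poly (fun c => decide (f c = g c)) := by
  have h1 : ∀ n (s : List (Data × Data) × Bool), esize (eqStep^[n] s).1 ≤ esize s.1 := by
    intro n
    induction n with
    | zero => simp
    | succ n ih =>
      intro s
      rw [Function.iterate_succ_apply]
      exact (ih _).trans (eqStep_esize s)
  -- The loop may stop before `n` rounds; since `eqStep` fixes a state without pending pairs, the
  -- remaining rounds change nothing.
  have h2 : ∀ n (s : List (Data × Data) × Bool), pendingSize s.1 ≤ n →
      ∃ m, m ≤ n ∧ (∀ j < m, (eqStep^[j] s).1 ≠ []) ∧ (eqStep^[m] s).1 = [] ∧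
        eqStep^[n] s = eqStep^[m] s := by
    intro n
    induction n with
    | zero =>
      intro s hs
      refine ⟨0, le_rfl, by simp, ?_, rfl⟩
      obtain ⟨_ | ⟨⟨x, y⟩, l⟩, b⟩ := s
      · simp
      · have := x.one_le_size
        simp [pendingSize] at hs
        omega
    | succ n ih =>
      intro s hs
      by_cases h0 : s.1 = []
      · refine ⟨0, by omega, by simp, h0, ?_⟩
        have : eqStep s = s := by
          obtain ⟨l, b⟩ := s
          subst h0
          simp [eqStep, Data.toList]
        rw [Function.iterate_fixed this, Function.iterate_zero_apply]
      · have := eqStep_pending s h0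
        obtain ⟨m, hm, h3, h4, h5⟩ := ih (eqStep s) (by omega)
        refine ⟨m + 1, by omega, fun j hj => ?_, h4, h5⟩
        rcases j with _ | j
        · exact h0
        · exact h3 j (by omega)
  have h4 : ∀ b : Bool, esize b ≤ 3 := by
    intro b; cases b <;> simp [esize, Data.size]
  have h5 : ∀ l : List (Data × Data), pendingSize l ≤ esize l := by
    intro l
    induction l with
    | nil => simp [pendingSize]
    | cons a l ih =>
      simp only [pendingSize, List.map_cons, List.sum_cons, esize_list_cons] at ih ⊢
      have : esize a = a.1.size + a.2.size + 1 := rfl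
      omega
  have h6 : Poly fun s : List (Data × Data) × Bool => eqStep^[pendingSize s.1] s := by
    refine loop (c := fun s => !decide (s.1 = [])) (f := eqStep) (by fun_prop) ?_
      (Polynomial.X + 4) fun s => ?_
    · unfold eqStep
      fun_prop
    · obtain ⟨m, hm, h3, h6, h7⟩ := h2 _ s le_rfl
      have h8 := h5 s.1
      have h9 : esize s = esize s.1 + esize s.2 + 1 := rfl
      refine ⟨m, ?_, ?_, ?_, h7, fun j hj => ?_⟩
      · simp only [Polynomial.eval_add, Polynomial.eval_X, Polynomial.eval_ofNat]
        omega
      · simpa using h3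
      · simpa using h6
      · have h10 : esize (eqStep^[j] s) =
          esize (eqStep^[j] s).1 + esize (eqStep^[j] s).2 + 1 := rfl
        have := h1 j s
        have := h4 (eqStep^[j] s).2
        simp only [Polynomial.eval_add, Polynomial.eval_X, Polynomial.eval_ofNat]
        omega
  have h : Poly fun c => (eqStep^[pendingSize ([(f c, g c)], true).1] ([(f c, g c)], true)).2 :=
    snd (comp (f := fun c => ([(f c, g c)], true)) h6 (by fun_prop))
  convert h using 2 with c
  rw [Bool.eq_iff_iff, eqStep_iterate _ _ le_rfl]
  simp

@[fun_prop]
theorem decide_eq [LawfulEnc α] {f g : γ → α} [∀ c, Decidable (f c = g c)] (hf : Poly f)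
    (hg : Poly g) : Poly (fun c => decide (f c = g c)) := by
  have he : Poly (fun a : α => (enc a : Data)) := of_enc_eq fun _ => rfl
  have h := decide_data_eq (he.comp hf) (he.comp hg)
  convert h using 3 with c
  exact ⟨fun h => by rw [h], fun h => LawfulEnc.inj h⟩

@[fun_prop]
theorem decide_mem [LawfulEnc α] {f : γ → α} {l : γ → List α} [∀ c, Decidable (f c ∈ l c)]
    (hf : Poly f) (hl : Poly l) : Poly (fun c => decide (f c ∈ l c)) := by
  classical
  have h : Poly (fun c => (l c).any fun a => decide (a = f c)) := by fun_prop
  convert h using 2 with c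
  rw [Bool.eq_iff_iff]
  simp

@[fun_prop]
theorem decide_iff {p q : γ → Prop} [∀ c, Decidable (p c)] [∀ c, Decidable (q c)]
    [∀ c, Decidable (p c ↔ q c)]
    (hp : Poly fun c => decide (p c)) (hq : Poly fun c => decide (q c)) :
    Poly (fun c => decide (p c ↔ q c)) := by
  have h : Poly (fun c => decide (decide (p c) = decide (q c))) := by fun_prop
  convert h using 2 with c
  rw [Bool.eq_iff_iff]
  simp

end Poly

/-! ## From weft-1 circuits to an independent set problem -/

/-- Circuits as plain lists of gates, each given by its kind and its predecessors. -/
abbrev Net := List (ℕ × List ℕ)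

/-- The value of gate `g` if the inputs in `K` are true, for gates of depth less than `d`. -/
def ev : ℕ → Net → List ℕ → ℕ → Bool
  | 0, _, _, _ => false
  | d + 1, G, K, g =>
    if (G.getD g (0, [])).1 = 0 then decide (g ∈ K)
    else if (G.getD g (0, [])).1 = 1 then (G.getD g (0, [])).2.all fun a => !ev d G K a
    else if (G.getD g (0, [])).1 = 2 then (G.getD g (0, [])).2.all fun a => ev d G K a
    else (G.getD g (0, [])).2.any fun a => ev d G K a

/-- The inputs below gate `g`, for gates of depth less than `d`. -/
def ins : ℕ → Net → ℕ → List ℕ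
  | 0, _, _ => []
  | d + 1, G, g =>
    if (G.getD g (0, [])).1 = 0 then [g]
    else (G.getD g (0, [])).2.flatMap fun a => ins d G a

/-- All concatenations of an element of `X` and an element of `Y`. -/
def mulCat {α : Type} (X Y : List (List α)) : List (List α) :=
  X.flatMap fun x => Y.map fun y => x ++ y

/-- Lists of conditions `(a, b)`, read as "gate `a` has value `b`", such that gate `g` has value
`b` if and only if all conditions of one of the lists hold. -/
def certs : ℕ → Net → ℕ → Bool → List (List (ℕ × Bool))
  | 0, _, _, _ => []
  | d + 1, G, g, b =>
    if (G.getD g (0, [])).1 = 0 then [[(g, b)]]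
    else if (G.getD g (0, [])).1 = 1 then (G.getD g (0, [])).2.flatMap fun a => certs d G a !b
    -- A true conjunction or a false disjunction requires the value `b` of all predecessors. A large
    -- gate ends the expansion with one condition per predecessor. With fan-in at most two the
    -- certificates of the predecessors are combined; the default `[[]]` stands for a missing
    -- predecessor and is neutral for `mulCat`.
    else if decide ((G.getD g (0, [])).1 = 2) = b then
      if 2 < (G.getD g (0, [])).2.length then [(G.getD g (0, [])).2.map fun a => (a, b)]
      else mulCat (((G.getD g (0, [])).2.map fun a => certs d G a b).getD 0 [[]])
        (((G.getD g (0, [])).2.map fun a => certs d G a b).getD 1 [[]])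
    else (G.getD g (0, [])).2.flatMap fun a => certs d G a b

/-- All words of length `n` over an alphabet. -/
def words {α : Type} (A : List α) : ℕ → List (List α)
  | 0 => [[]]
  | n + 1 => A.flatMap fun a => (words A n).map fun w => a :: w

/-- Partial choices of a single element of `X` for one of `k` positions. -/
def letters (k : ℕ) (X : List ℕ) : List (List (ℕ × ℕ)) :=
  [] :: (List.range k).flatMap fun i => X.map fun x => [(i, x)]

/-- Whether a relation between positions and inputs is a partial injection. -/
def compat (R R' : List (ℕ × ℕ)) : Bool :=
  R.all fun x => R'.all fun y => decide (x.1 = y.1 ↔ x.2 = y.2)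

/-- The conditions of `e` that fail for the inputs in `R`. -/
def failing (d : ℕ) (G : Net) (e : List (ℕ × Bool)) (R : List (ℕ × ℕ)) : List (ℕ × Bool) :=
  e.filter fun c => !decide (ev d G (R.map fun x => x.2) c.1 = c.2)

/-- One step of the search for a set of inputs that satisfies all conditions. -/
def searchStep (d : ℕ) (G : Net) (e : List (ℕ × Bool)) (R : List (ℕ × ℕ)) (c : ℕ × ℕ) :
    List (ℕ × ℕ) :=
  if failing d G e R = [] then R
  -- The choice `c` guesses a position and an index among the inputs below the first failing
  -- condition.
  else R ++ [(c.1, (ins d G ((failing d G e R).headD (0, false)).1).getD c.2 0)]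

/-- Local views: a list of conditions, choices for some positions, and a partial injection that
extends them and satisfies the conditions. -/
abbrev View := List (ℕ × Bool) × List (List (ℕ × ℕ)) × List (ℕ × ℕ)

/-- The positions that a view has to fill. -/
def View.slot (v : View) : List (List ℕ) := v.2.1.map fun l => l.map fun x => x.1

/-- Incompatible views. -/
def View.conflict (v v' : View) : Bool :=
  !decide (v.1 = v'.1) || decide (v.slot = v'.slot) || !compat v.2.2 v'.2.2

/-- The list of all views. -/
def views (d q : ℕ) (G : Net) (E : List (List (ℕ × Bool))) (X : List ℕ) (k : ℕ)
    (C : List (List (ℕ × ℕ))) : List View :=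
  (E.flatMap fun e => (words (letters k X) q).flatMap fun w => C.map fun c =>
    (e, w, c.foldl (fun R a => searchStep d G e R a) w.flatten)).filter fun v =>
      decide (failing d G v.1 v.2.2 = []) && compat v.2.2 v.2.2

/-! ### Polynomial running time of the construction of views -/

namespace Poly
variable {α β γ : Type} [Enc α] [Enc β] [Enc γ]

-- Here, and for `ins` and `certs`, the depth bound `d` is a constant: the recursion unfolds into a
-- fixed program for each `d`. This is where bounded depth enters the running time.
@[fun_prop]
theorem ev (d : ℕ) {G : γ → Net} {K : γ → List ℕ} {g : γ → ℕ} (hG : Poly G) (hK : Poly K)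
    (hg : Poly g) : Poly fun c => ev d (G c) (K c) (g c) := by
  have : Poly fun x : Net × List ℕ × ℕ => ParamCSP.ev d x.1 x.2.1 x.2.2 := by
    induction d with
    | zero => exact const false
    | succ d ih =>
      have h : Poly fun x : (Net × List ℕ × ℕ) × ℕ => ParamCSP.ev d x.1.1 x.1.2.1 x.2 :=
        comp (f := fun x : (Net × List ℕ × ℕ) × ℕ => (x.1.1, x.1.2.1, x.2)) ih (by fun_prop)
      simp only [ParamCSP.ev]
      fun_prop
  exact comp this (hG.pair (hK.pair hg))

@[fun_prop]
theorem ins (d : ℕ) {G : γ → Net} {g : γ → ℕ} (hG : Poly G)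
    (hg : Poly g) : Poly fun c => ins d (G c) (g c) := by
  have : Poly fun x : Net × ℕ => ParamCSP.ins d x.1 x.2 := by
    induction d with
    | zero => exact const []
    | succ d ih =>
      have h : Poly fun x : (Net × ℕ) × ℕ => ParamCSP.ins d x.1.1 x.2 :=
        comp (f := fun x : (Net × ℕ) × ℕ => (x.1.1, x.2)) ih (by fun_prop)
      simp only [ParamCSP.ins]
      fun_prop
  exact comp this (hG.pair hg)

@[fun_prop]
theorem mulCat {X Y : γ → List (List α)} (hX : Poly X) (hY : Poly Y) :
    Poly fun c => mulCat (X c) (Y c) := by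
  unfold ParamCSP.mulCat
  fun_prop

@[fun_prop]
theorem certs (d : ℕ) {G : γ → Net} {g : γ → ℕ} {b : γ → Bool} (hG : Poly G)
    (hg : Poly g) (hb : Poly b) : Poly fun c => certs d (G c) (g c) (b c) := by
  have : Poly fun x : Net × ℕ × Bool => ParamCSP.certs d x.1 x.2.1 x.2.2 := by
    induction d with
    | zero => exact const []
    | succ d ih =>
      have h : Poly fun x : (Net × ℕ × Bool) × ℕ => ParamCSP.certs d x.1.1 x.2 x.1.2.2 :=
        comp (f := fun x : (Net × ℕ × Bool) × ℕ => (x.1.1, x.2, x.1.2.2)) ih (by fun_prop)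
      have h' : Poly fun x : (Net × ℕ × Bool) × ℕ => ParamCSP.certs d x.1.1 x.2 !x.1.2.2 :=
        comp (f := fun x : (Net × ℕ × Bool) × ℕ => (x.1.1, x.2, !x.1.2.2)) ih (by fun_prop)
      simp only [ParamCSP.certs]
      fun_prop
  exact comp this (hG.pair (hg.pair hb))

-- Polynomial because the word length `q` is a constant; words whose length is the weight `k` are
-- treated in `exists_run_words`.
@[fun_prop]
theorem words (q : ℕ) {A : γ → List α} (hA : Poly A) : Poly fun c => words (A c) q := by
  have : Poly fun A : List α => ParamCSP.words A q := by
    induction q with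
    | zero => exact const [[]]
    | succ q ih =>
      simp only [ParamCSP.words]
      fun_prop
  exact comp this hA

@[fun_prop]
theorem letters {k : γ → ℕ} {X : γ → List ℕ} (hk : Poly k) (hX : Poly X) :
    Poly fun c => letters (k c) (X c) := by
  unfold ParamCSP.letters
  fun_prop

@[fun_prop]
theorem compat {R R' : γ → List (ℕ × ℕ)} (hR : Poly R) (hR' : Poly R') :
    Poly fun c => compat (R c) (R' c) := by
  unfold ParamCSP.compat
  fun_prop

@[fun_prop]
theorem failing (d : ℕ) {G : γ → Net} {e : γ → List (ℕ × Bool)} {R : γ → List (ℕ × ℕ)}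
    (hG : Poly G) (he : Poly e) (hR : Poly R) : Poly fun c => failing d (G c) (e c) (R c) := by
  unfold ParamCSP.failing
  fun_prop

@[fun_prop]
theorem searchStep (d : ℕ) {G : γ → Net} {e : γ → List (ℕ × Bool)} {R : γ → List (ℕ × ℕ)}
    {a : γ → ℕ × ℕ} (hG : Poly G) (he : Poly e) (hR : Poly R) (ha : Poly a) :
    Poly fun c => searchStep d (G c) (e c) (R c) (a c) := by
  unfold ParamCSP.searchStep
  fun_prop

lemma esize_getD_le (l : List ℕ) (n : ℕ) : esize (l.getD n 0) ≤ esize l := by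
  rcases lt_or_ge n l.length with h | h
  · rw [List.getD_eq_getElem _ _ h]
    exact esize_le_of_mem (List.getElem_mem h)
  · rw [List.getD_eq_default _ _ h]
    exact one_le_esize l

-- A step appends at most one pair, made of a given position and an input below some condition of
-- `e`. Its size is bounded independently of the accumulated `R`.
@[fun_prop]
theorem search (d : ℕ) {G : γ → Net} {e : γ → List (ℕ × Bool)} {R : γ → List (ℕ × ℕ)}
    {l : γ → List (ℕ × ℕ)} (hG : Poly G) (he : Poly e) (hR : Poly R) (hl : Poly l) :
    Poly fun c => (l c).foldl (fun R a => ParamCSP.searchStep d (G c) (e c) R a) (R c) := by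
  refine foldl (f := fun c R a => ParamCSP.searchStep d (G c) (e c) R a) (by fun_prop) hl hR ?_
  have h : Poly fun c => (e c).map fun x => ParamCSP.ins d (G c) x.1 := by fun_prop
  obtain ⟨P, hP⟩ := output_size h
  refine ⟨P + Polynomial.X + 3, fun c R a => ?_⟩
  simp only [Polynomial.eval_add, Polynomial.eval_X, Polynomial.eval_ofNat]
  unfold ParamCSP.searchStep
  split_ifs with h0
  · omega
  · have hmem : (ParamCSP.failing d (G c) (e c) R).headD (0, false) ∈ e c := by
      rcases hf : ParamCSP.failing d (G c) (e c) R with _ | ⟨x, l⟩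
      · exact absurd hf h0
      · have : x ∈ ParamCSP.failing d (G c) (e c) R := by simp [hf]
        exact (List.mem_filter.1 this).1
    have h1 := esize_le_of_mem (List.mem_map_of_mem
      (f := fun x : ℕ × Bool => ParamCSP.ins d (G c) x.1) hmem)
    have h2 := hP c
    have h3 := esize_getD_le (ParamCSP.ins d (G c)
      ((ParamCSP.failing d (G c) (e c) R).headD (0, false)).1) a.2
    have h4 := esize_append R [(a.1, (ParamCSP.ins d (G c)
      ((ParamCSP.failing d (G c) (e c) R).headD (0, false)).1).getD a.2 0)]
    have h5 : esize a = esize a.1 + esize a.2 + 1 := rfl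
    have h6 := eval_nat_mono P (show esize c ≤ esize (c, a) by simp; omega)
    simp only [esize_list_cons, esize_list_nil, esize_prod] at *
    omega

@[fun_prop]
theorem slot {v : γ → View} (hv : Poly v) : Poly fun c => (v c).slot := by
  unfold View.slot
  fun_prop

@[fun_prop]
theorem conflict {v v' : γ → View} (hv : Poly v) (hv' : Poly v') :
    Poly fun c => (v c).conflict (v' c) := by
  unfold View.conflict
  fun_prop

@[fun_prop]
theorem views (d q : ℕ) {G : γ → Net} {E : γ → List (List (ℕ × Bool))} {X : γ → List ℕ} {k : γ → ℕ}
    {C : γ → List (List (ℕ × ℕ))} (hG : Poly G) (hE : Poly E) (hX : Poly X) (hk : Poly k)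
    (hC : Poly C) : Poly fun c => views d q (G c) (E c) (X c) (k c) (C c) := by
  unfold ParamCSP.views
  fun_prop

end Poly

/-! ### Words, slots and the bounded search -/

lemma mem_words {α : Type} {A : List α} {n : ℕ} {w : List α} :
    w ∈ words A n ↔ w.length = n ∧ ∀ a ∈ w, a ∈ A := by
  induction n generalizing w with
  | zero => cases w <;> simp [words]
  | succ n ih =>
    cases w with
    | nil => simp [words]
    | cons a w =>
      simp only [words, List.mem_flatMap, List.mem_map, ih, List.length_cons, List.mem_cons]
      constructor
      · rintro ⟨b, hb, v, ⟨hv, hv'⟩, h⟩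
        obtain ⟨rfl, rfl⟩ := List.cons.inj h
        exact ⟨by omega, by rintro c (rfl | hc); exacts [hb, hv' c hc]⟩
      · rintro ⟨h1, h2⟩
        exact ⟨a, h2 a (.inl rfl), w, ⟨by omega, fun c hc => h2 c (.inr hc)⟩, rfl⟩

lemma nodup_words {α : Type} {A : List α} (hA : A.Nodup) (n : ℕ) : (words A n).Nodup := by
  induction n with
  | zero => simp [words]
  | succ n ih =>
    refine List.nodup_flatMap.2 ⟨fun a _ => ih.map (List.cons_injective), ?_⟩
    refine hA.imp fun {a b} hab => ?_
    simp only [Function.onFun, List.disjoint_left, List.mem_map]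
    rintro _ ⟨v, _, rfl⟩ ⟨w, _, h⟩
    exact hab (List.cons.inj h).1.symm

/-- All possible slots of views. -/
def slots (k q : ℕ) : List (List (List ℕ)) := words ([] :: (List.range k).map fun i => [i]) q

lemma nodup_slots (k q : ℕ) : (slots k q).Nodup := by
  refine nodup_words ?_ q
  simp only [List.nodup_cons, List.mem_map]
  refine ⟨by simp, List.nodup_range.map fun i j h => by simpa using h⟩

/-- The choices made in a search. -/
def choices (k q : ℕ) : List (ℕ × ℕ) :=
  (List.range k).flatMap fun i => (List.range q).map fun j => (i, j)

lemma mem_choices {k q : ℕ} {c : ℕ × ℕ} : c ∈ choices k q ↔ c.1 < k ∧ c.2 < q := by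
  obtain ⟨i, j⟩ := c
  simp [choices]

lemma ev_congr {d : ℕ} {G : Net} {K K' : List ℕ} {g : ℕ} (h : ∀ x ∈ ins d G g, x ∈ K ↔ x ∈ K') :
    ev d G K g = ev d G K' g := by
  induction d generalizing g with
  | zero => rfl
  | succ d ih =>
    simp only [ins] at h
    simp only [ev]
    split_ifs with h0 h1 h2
    · rw [if_pos h0] at h
      simpa using h
    all_goals
      rw [if_neg h0] at h
      have h3 : ∀ a ∈ (G.getD g (0, [])).2, ev d G K a = ev d G K' a := fun a ha =>
        ih fun x hx => h x (List.mem_flatMap.2 ⟨a, ha, hx⟩)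
      rw [Bool.eq_iff_iff]
      simp only [List.all_eq_true, List.any_eq_true]
    · exact forall₂_congr fun a ha => by rw [h3 a ha]
    · exact forall₂_congr fun a ha => by rw [h3 a ha]
    · exact exists_congr fun a => and_congr_right fun ha => by rw [h3 a ha]

lemma mem_failing {d : ℕ} {G : Net} {e : List (ℕ × Bool)} {R : List (ℕ × ℕ)} {c : ℕ × Bool} :
    c ∈ failing d G e R ↔ c ∈ e ∧ ev d G (R.map fun x => x.2) c.1 ≠ c.2 := by
  simp [failing]

lemma compat_iff {R R' : List (ℕ × ℕ)} :
    compat R R' = true ↔ ∀ x ∈ R, ∀ y ∈ R', x.1 = y.1 ↔ x.2 = y.2 := by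
  simp [compat]

lemma mem_letters {k : ℕ} {X : List ℕ} {l : List (ℕ × ℕ)} :
    l ∈ letters k X ↔ l = [] ∨ ∃ i x, i < k ∧ x ∈ X ∧ l = [(i, x)] := by
  simp only [letters, List.mem_cons, List.mem_flatMap, List.mem_range, List.mem_map]
  constructor
  · rintro (h | ⟨i, hi, x, hx, rfl⟩)
    exacts [.inl h, .inr ⟨i, x, hi, hx, rfl⟩]
  · rintro (h | ⟨i, x, hi, hx, rfl⟩)
    exacts [.inl h, .inr ⟨i, hi, x, hx, rfl⟩]

section Search
variable {d q k : ℕ} {G : Net} {e : List (ℕ × Bool)}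

lemma subset_search (c : List (ℕ × ℕ)) (R : List (ℕ × ℕ)) :
    R ⊆ c.foldl (fun R a => searchStep d G e R a) R := by
  induction c generalizing R with
  | nil => exact fun _ h => h
  | cons a c ih =>
    refine List.Subset.trans ?_ (ih _)
    simp only [searchStep]
    split_ifs
    · exact fun _ h => h
    · exact List.subset_append_left _ _

lemma search_lt (c : List (ℕ × ℕ)) (R : List (ℕ × ℕ)) (hR : ∀ x ∈ R, x.1 < k)
    (hc : ∀ x ∈ c, x.1 < k) : ∀ x ∈ c.foldl (fun R a => searchStep d G e R a) R, x.1 < k := by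
  induction c generalizing R with
  | nil => exact hR
  | cons a c ih =>
    refine ih _ ?_ fun x hx => hc x (by simp [hx])
    simp only [searchStep]
    split_ifs
    · exact hR
    · intro x hx
      rcases List.mem_append.1 hx with hx | hx
      · exact hR x hx
      · rw [List.mem_singleton.1 hx]
        exact hc a (by simp)

lemma search_of_failing_eq_nil (c : List (ℕ × ℕ)) {R : List (ℕ × ℕ)} (hR : failing d G e R = []) :
    c.foldl (fun R a => searchStep d G e R a) R = R := by
  induction c with
  | nil => rfl
  | cons a c ih => rw [List.foldl_cons, searchStep, if_pos hR, ih]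

/-- A bounded search tree guided by the solution `L`. As long as `R`, a part of `L`, violates a
condition, some entry of `L` below that condition is missing from `R`. Adding it decreases the
number `m` of missing entries. -/
lemma exists_search {L : List ℕ} (hk : L.length = k) (hq : 1 ≤ q)
    (hins : ∀ c ∈ e, (ins d G c.1).length ≤ q) (hL : ∀ c ∈ e, ev d G L c.1 = c.2) (m : ℕ)
    (hm : m ≤ k) (R : List (ℕ × ℕ)) (hR : ∀ x ∈ R, L[x.1]? = some x.2)
    (hRm : (L.filter fun x => !decide (x ∈ R.map fun x => x.2)).length ≤ m) :
    ∃ c ∈ words (choices k q) m, (∀ x ∈ c.foldl (fun R a => searchStep d G e R a) R,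
      L[x.1]? = some x.2) ∧ failing d G e (c.foldl (fun R a => searchStep d G e R a) R) = [] := by
  induction m generalizing R with
  | zero =>
    refine ⟨[], by simp [words], hR, ?_⟩
    rw [List.foldl_nil, List.eq_nil_iff_forall_not_mem]
    intro c hc
    obtain ⟨hc, hc'⟩ := mem_failing.1 hc
    rw [← hL c hc] at hc'
    refine hc' (ev_congr fun x _ => ⟨fun hx => ?_, fun hx => ?_⟩)
    · obtain ⟨y, hy, rfl⟩ := List.mem_map.1 hx
      exact List.mem_of_getElem? (hR y hy)
    · have := List.filter_eq_nil_iff.1 (List.eq_nil_of_length_eq_zero (Nat.le_zero.1 hRm)) x hx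
      simpa using this
  | succ m ih =>
    by_cases h0 : failing d G e R = []
    -- The search is already finished, so the word is padded with choices that have no effect.
    · refine ⟨List.replicate (m + 1) (0, 0), mem_words.2 ⟨by simp, fun a ha => ?_⟩, ?_⟩
      · rw [List.eq_of_mem_replicate ha, mem_choices]
        exact ⟨by omega, by omega⟩
      · rw [search_of_failing_eq_nil _ h0]
        exact ⟨hR, h0⟩
    · have hmem : (failing d G e R).headD (0, false) ∈ failing d G e R := by
        cases hf : failing d G e R with
        | nil => exact absurd hf h0
        | cons a l => simp
      obtain ⟨he, hev⟩ := mem_failing.1 hmem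
      set c := (failing d G e R).headD (0, false) with hc
      rw [← hL c he] at hev
      -- `R` uses entries of `L` only. If it contained all entries of `L` below the gate, both would
      -- give the gate the same value.
      have hx : ∃ x ∈ ins d G c.1, x ∈ L ∧ x ∉ R.map fun x => x.2 := by
        by_contra! hcon
        refine hev (ev_congr fun x hx => ⟨fun h => ?_, hcon x hx⟩)
        obtain ⟨y, hy, rfl⟩ := List.mem_map.1 h
        exact List.mem_of_getElem? (hR y hy)
      obtain ⟨x, hx, hxL, hxR⟩ := hx
      obtain ⟨j, hj, rfl⟩ := List.mem_iff_getElem.1 hx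
      obtain ⟨i, hi, hij⟩ := List.mem_iff_getElem.1 hxL
      have hstep : searchStep d G e R (i, j) = R ++ [(i, (ins d G c.1)[j])] := by
        rw [searchStep, if_neg h0, ← hc, List.getD_eq_getElem _ _ hj]
      obtain ⟨w, hw, hw1, hw2⟩ := ih (by omega) (searchStep d G e R (i, j)) (by
        rw [hstep]
        intro y hy
        rcases List.mem_append.1 hy with hy | hy
        · exact hR y hy
        · rw [List.mem_singleton.1 hy]
          simp [← hij, hi]) (by
        refine Nat.le_of_lt_succ (lt_of_lt_of_le ?_ hRm)
        have : (L.filter fun x => !decide (x ∈ (searchStep d G e R (i, j)).map fun x => x.2)) =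
            (L.filter fun x => !decide (x ∈ R.map fun x => x.2)).filter
              fun x => !decide (x = (ins d G c.1)[j]) := by
          rw [hstep, List.filter_filter]
          congr 1
          funext x
          rw [Bool.eq_iff_iff]
          simp only [List.map_append, List.mem_append, Bool.not_eq_true', Bool.and_eq_true,
            decide_eq_false_iff_not, List.map_cons, List.map_nil, List.mem_singleton]
          tauto
        rw [this, List.length_filter_lt_length_iff_exists]
        exact ⟨_, List.mem_filter.2 ⟨hxL, by simpa using hxR⟩, by simp⟩)
      refine ⟨(i, j) :: w, ?_, hw1, hw2⟩
      rw [mem_words] at hw ⊢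
      refine ⟨by simp [hw.1], fun a ha => ?_⟩
      rcases List.mem_cons.1 ha with rfl | ha
      · exact mem_choices.2 ⟨hk ▸ hi, lt_of_lt_of_le hj (hins c he)⟩
      · exact hw.2 a ha

end Search

lemma mem_views {d q : ℕ} {G : Net} {E : List (List (ℕ × Bool))} {X : List ℕ} {k : ℕ}
    {C : List (List (ℕ × ℕ))} {v : View} : v ∈ views d q G E X k C ↔
    v.1 ∈ E ∧ v.2.1 ∈ words (letters k X) q ∧
      (∃ c ∈ C, v.2.2 = c.foldl (fun R a => searchStep d G v.1 R a) v.2.1.flatten) ∧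
      failing d G v.1 v.2.2 = [] ∧ compat v.2.2 v.2.2 = true := by
  obtain ⟨e, w, R⟩ := v
  simp only [views, List.mem_filter, List.mem_flatMap, List.mem_map, Bool.and_eq_true,
    decide_eq_true_eq]
  constructor
  · rintro ⟨⟨e', he, w', hw, c, hc, h⟩, h1, h2⟩
    simp only [Prod.mk.injEq] at h
    obtain ⟨rfl, rfl, rfl⟩ := h
    exact ⟨he, hw, ⟨c, hc, rfl⟩, h1, h2⟩
  · rintro ⟨he, hw, ⟨c, hc, h⟩, h1, h2⟩
    exact ⟨⟨e, he, w, hw, c, hc, by rw [h]⟩, h1, h2⟩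

lemma conflict_eq_false {v v' : View} : v.conflict v' = false ↔
    v.1 = v'.1 ∧ v.slot ≠ v'.slot ∧ compat v.2.2 v'.2.2 = true := by
  simp [View.conflict, and_assoc]

/-! ### Independent sets of views correspond to solutions -/

section Correct
variable {d q k : ℕ} {G : Net} {E : List (List (ℕ × Bool))} {X : List ℕ}

/-- The list `L` assigns an input to each position. Each slot is filled according to `L` and
completed inside `L`; since `L` has no repetitions, parts of it are pairwise compatible. -/
theorem exists_independent (hq : 1 ≤ q) (hins : ∀ e ∈ E, ∀ c ∈ e, (ins d G c.1).length ≤ q)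
    {L : List ℕ} (hL : L.Nodup) (hk : L.length = k) (hX : L ⊆ X) {e : List (ℕ × Bool)} (he : e ∈ E)
    (hev : ∀ c ∈ e, ev d G L c.1 = c.2) {V : List View}
    (hV : V = views d q G E X k (words (choices k q) k)) :
    ∃ S : Finset (Fin V.length), (∀ i ∈ S, ∀ j ∈ S, i ≠ j → V[i].conflict V[j] = false) ∧
      S.card = (slots k q).length := by
  have hsl : ∀ s ∈ slots k q, ∃ i : Fin V.length, V[i].1 = e ∧ V[i].slot = s ∧
      ∀ x ∈ V[i].2.2, L[x.1]? = some x.2 := by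
    intro s hs
    obtain ⟨hs1, hs2⟩ := mem_words.1 hs
    set w : List (List (ℕ × ℕ)) := s.map fun l => l.map fun i => (i, L.getD i 0) with hw
    have hs3 : ∀ l ∈ s, ∀ i ∈ l, i < k := by
      intro l hl i hi
      rcases List.mem_cons.1 (hs2 l hl) with rfl | h
      · simp at hi
      · obtain ⟨j, hj, rfl⟩ := List.mem_map.1 h
        rw [List.mem_singleton.1 hi]
        exact List.mem_range.1 hj
    have hget : ∀ i < k, L[i]? = some (L.getD i 0) := by
      intro i hi
      rw [List.getD_eq_getElem _ _ (hk ▸ hi), List.getElem?_eq_getElem]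
    -- At most `k` entries of `L` can be missing at the start, so `k` search steps suffice.
    obtain ⟨c, hc, hc1, hc2⟩ := exists_search hk hq (hins e he) hev k le_rfl w.flatten (by
      intro x hx
      obtain ⟨l, hl, hx⟩ := List.mem_flatten.1 hx
      obtain ⟨l, hl', rfl⟩ := List.mem_map.1 hl
      obtain ⟨i, hi, rfl⟩ := List.mem_map.1 hx
      exact hget i (hs3 l hl' i hi)) ((List.length_filter_le _ _).trans hk.le)
    have hv : (e, w, c.foldl (fun R a => searchStep d G e R a) w.flatten) ∈ V := by
      rw [hV, mem_views]
      refine ⟨he, mem_words.2 ⟨by simp [hw, hs1], ?_⟩, ⟨c, hc, rfl⟩, hc2, compat_iff.2 ?_⟩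
      · intro l hl
        obtain ⟨l, hl', rfl⟩ := List.mem_map.1 hl
        rcases List.mem_cons.1 (hs2 l hl') with rfl | h
        · exact mem_letters.2 (.inl rfl)
        · obtain ⟨j, hj, rfl⟩ := List.mem_map.1 h
          refine mem_letters.2 (.inr ⟨j, L.getD j 0, List.mem_range.1 hj, hX ?_, rfl⟩)
          exact List.mem_of_getElem? (hget j (List.mem_range.1 hj))
      · intro x hx y hy
        have h1 := hc1 x hx
        have h2 := hc1 y hy
        constructor
        · intro h
          rw [h, h2] at h1
          simpa using h1.symm
        · intro h
          rw [← h, ← h1] at h2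
          obtain ⟨h3, -⟩ := List.getElem?_eq_some_iff.1 h1
          exact ((List.getElem?_inj h3 hL).1 h2.symm)
    obtain ⟨i, hi, hiv⟩ := List.mem_iff_getElem.1 hv
    refine ⟨⟨i, hi⟩, ?_⟩
    simp only [Fin.getElem_fin, hiv]
    refine ⟨trivial, ?_, hc1⟩
    simp [View.slot, hw, Function.comp_def]
  choose f hf1 hf2 hf3 using hsl
  refine ⟨(slots k q).toFinset.attach.image fun s => f s.1 (List.mem_toFinset.1 s.2), ?_, ?_⟩
  · simp only [Finset.mem_image, Finset.mem_attach, true_and]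
    rintro _ ⟨s, rfl⟩ _ ⟨t, rfl⟩ hst
    refine conflict_eq_false.2 ⟨by rw [hf1, hf1], ?_, compat_iff.2 fun x hx y hy => ?_⟩
    · rw [hf2, hf2]
      rintro h
      exact hst (by simp only [h])
    · have h1 := hf3 _ _ x hx
      have h2 := hf3 _ _ y hy
      constructor
      · intro h
        rw [h, h2] at h1
        simpa using h1.symm
      · intro h
        rw [← h, ← h1] at h2
        obtain ⟨h3, -⟩ := List.getElem?_eq_some_iff.1 h1
        exact ((List.getElem?_inj h3 hL).1 h2.symm)
  · rw [Finset.card_image_of_injective, Finset.card_attach,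
      List.toFinset_card_of_nodup (nodup_slots k q)]
    intro s t h
    have h1 := hf2 s.1 (List.mem_toFinset.1 s.2)
    dsimp only at h
    rw [h, hf2] at h1
    exact Subtype.ext h1.symm

/-- The views of a large independent set share one list of conditions and glue to an injection `τ`
on the positions. A condition is verified in the view whose slot names exactly the positions with
inputs below it. -/
theorem exists_solution (hq : 1 ≤ q) (hins : ∀ e ∈ E, ∀ c ∈ e, (ins d G c.1).length ≤ q)
    {V : List View} (hV : V = views d q G E X k (words (choices k q) k))
    (S : Finset (Fin V.length)) (hS : ∀ i ∈ S, ∀ j ∈ S, i ≠ j → V[i].conflict V[j] = false)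
    (hN : (slots k q).length ≤ S.card) :
    ∃ L : List ℕ, L.Nodup ∧ L.length = k ∧ L ⊆ X ∧ ∃ e ∈ E, ∀ c ∈ e, ev d G L c.1 = c.2 := by
  have hmem : ∀ i : Fin V.length, V[i] ∈ views d q G E X k (words (choices k q) k) := fun i => by
    rw [← hV]; exact List.getElem_mem _
  have hslot : ∀ i : Fin V.length, V[i].slot ∈ slots k q := by
    intro i
    obtain ⟨-, h, -⟩ := mem_views.1 (hmem i)
    obtain ⟨h1, h2⟩ := mem_words.1 h
    refine mem_words.2 ⟨(List.length_map _).trans h1, fun l' hl' => ?_⟩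
    obtain ⟨l, hl, rfl⟩ := List.mem_map.1 hl'
    rcases mem_letters.1 (h2 l hl) with rfl | ⟨j, x, hj, -, rfl⟩
    · simp
    · simp [hj]
  -- Distinct views in `S` have distinct slots, and `S` has at least as many elements as there are
  -- slots.
  have hsurj : ∀ s ∈ slots k q, ∃ i ∈ S, V[i].slot = s := by
    have himg : S.image (fun i => V[i].slot) = (slots k q).toFinset := by
      refine Finset.eq_of_subset_of_card_le ?_ ?_
      · intro s hs
        obtain ⟨i, -, rfl⟩ := Finset.mem_image.1 hs
        exact List.mem_toFinset.2 (hslot i)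
      · rw [List.toFinset_card_of_nodup (nodup_slots k q), Finset.card_image_of_injOn]
        · exact hN
        · intro i hi j hj hij
          by_contra hne
          exact (conflict_eq_false.1 (hS i hi j hj hne)).2.1 hij
    intro s hs
    have := List.mem_toFinset.2 hs
    rw [← himg] at this
    simpa using this
  have hcompat : ∀ i ∈ S, ∀ j ∈ S, ∀ x ∈ V[i].2.2, ∀ y ∈ V[j].2.2, x.1 = y.1 ↔ x.2 = y.2 := by
    intro i hi j hj
    by_cases hij : i = j
    · subst hij
      exact compat_iff.1 (mem_views.1 (hmem i)).2.2.2.2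
    · exact compat_iff.1 (conflict_eq_false.1 (hS i hi j hj hij)).2.2
  have hlt : ∀ i : Fin V.length, ∀ x ∈ V[i].2.2, x.1 < k := by
    intro i
    obtain ⟨-, h, ⟨c, hc, hc'⟩, -⟩ := mem_views.1 (hmem i)
    rw [hc']
    refine search_lt _ _ ?_ fun x hx => (mem_choices.1 ((mem_words.1 hc).2 x hx)).1
    intro x hx
    obtain ⟨l, hl, hx⟩ := List.mem_flatten.1 hx
    rcases mem_letters.1 ((mem_words.1 h).2 l hl) with rfl | ⟨j, y, hj, -, rfl⟩
    · simp at hx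
    · rw [List.mem_singleton.1 hx]
      exact hj
  have hpick : ∀ i : Fin V.length, ∀ p, [p] ∈ V[i].slot → ∃ x ∈ X, (p, x) ∈ V[i].2.2 := by
    intro i p hp
    obtain ⟨-, h, ⟨c, hc, hc'⟩, -⟩ := mem_views.1 (hmem i)
    obtain ⟨l, hl, hlp⟩ := List.mem_map.1 hp
    rcases mem_letters.1 ((mem_words.1 h).2 l hl) with rfl | ⟨j, y, hj, hy, rfl⟩
    · simp at hlp
    · obtain rfl : j = p := by simpa using hlp
      refine ⟨y, hy, ?_⟩
      rw [hc']
      exact subset_search _ _ (List.mem_flatten.2 ⟨_, hl, by simp⟩)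
  have hτ : ∀ p < k, ∃ x ∈ X, ∃ i ∈ S, (p, x) ∈ V[i].2.2 := by
    intro p hp
    -- The slot naming `p` in all `q` places, at least one, yields the input at position `p`.
    obtain ⟨i, hi, his⟩ := hsurj (List.replicate q [p]) (mem_words.2 ⟨by simp, fun l hl => by
      rw [List.eq_of_mem_replicate hl]
      simp [hp]⟩)
    obtain ⟨x, hx, h⟩ := hpick i p (by rw [his]; simp; omega)
    exact ⟨x, hx, i, hi, h⟩
  choose! τ hτX idx hidx hτi using hτ
  have hτeq : ∀ i ∈ S, ∀ x ∈ V[i].2.2, x.2 = τ x.1 := fun i hi x hx =>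
    (hcompat i hi _ (hidx x.1 (hlt i x hx)) x hx _ (hτi x.1 (hlt i x hx))).1 rfl
  have hτinj : ∀ p < k, ∀ p' < k, τ p = τ p' → p = p' := fun p hp p' hp' h =>
    (hcompat _ (hidx p hp) _ (hidx p' hp') _ (hτi p hp) _ (hτi p' hp')).2 h
  -- Any view of `S` would do; it supplies the common list of conditions. The empty slot provides
  -- one even for `k = 0`.
  obtain ⟨i₀, hi₀, -⟩ := hsurj (List.replicate q []) (mem_words.2 ⟨by simp, fun l hl => by
    rw [List.eq_of_mem_replicate hl]; simp⟩)
  refine ⟨(List.range k).map τ, ?_, by simp, ?_, V[i₀].1, (mem_views.1 (hmem i₀)).1, fun c hc => ?_⟩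
  · exact List.nodup_range.map_on fun p hp p' hp' =>
      hτinj p (List.mem_range.1 hp) p' (List.mem_range.1 hp')
  · intro x hx
    obtain ⟨p, hp, rfl⟩ := List.mem_map.1 hx
    exact hτX p (List.mem_range.1 hp)
  -- `I` collects the positions with inputs below `c`. It has at most `q` elements because `τ` is
  -- injective and `c` depends on at most `q` inputs.
  · set I := (List.range k).filter fun p => decide (τ p ∈ ins d G c.1) with hI
    have hIlen : I.length ≤ q := by
      have h1 : (I.map τ).Nodup := (List.nodup_range.filter _).map_on fun p hp p' hp' =>
        hτinj p (List.mem_range.1 (List.mem_filter.1 hp).1) p'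
          (List.mem_range.1 (List.mem_filter.1 hp').1)
      have h2 : I.map τ ⊆ ins d G c.1 := by
        intro x hx
        obtain ⟨p, hp, rfl⟩ := List.mem_map.1 hx
        simpa using (List.mem_filter.1 hp).2
      have h3 := (List.subperm_of_subset h1 h2).length_le
      rw [List.length_map] at h3
      exact h3.trans (hins _ (mem_views.1 (hmem i₀)).1 c hc)
    -- Empty letters pad `I` to a slot of length `q`.
    obtain ⟨i, hi, his⟩ := hsurj ((I.map fun p => [p]) ++ List.replicate (q - I.length) [])
      (mem_words.2 ⟨by simp; omega, fun l hl => by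
        rcases List.mem_append.1 hl with hl | hl
        · obtain ⟨p, hp, rfl⟩ := List.mem_map.1 hl
          have := List.mem_range.1 (List.mem_filter.1 hp).1
          simp [this]
        · rw [List.eq_of_mem_replicate hl]; simp⟩)
    have hbr : V[i].1 = V[i₀].1 := by
      by_cases h : i = i₀
      · rw [h]
      · exact (conflict_eq_false.1 (hS i hi i₀ hi₀ h)).1
    have hfail := (mem_views.1 (hmem i)).2.2.2.1
    have hR : ev d G (V[i].2.2.map fun x => x.2) c.1 = c.2 := by
      by_contra hne
      have : c ∈ failing d G V[i].1 V[i].2.2 := mem_failing.2 ⟨hbr ▸ hc, hne⟩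
      rw [hfail] at this
      simp at this
    rw [← hR]
    -- On the inputs below `c` the two lists agree: the view contains the pair `(p, τ p)` for every
    -- `p` in `I`, and all its pairs have this form.
    refine ev_congr fun x hx => ⟨fun h => ?_, fun h => ?_⟩
    · obtain ⟨p, hp, rfl⟩ := List.mem_map.1 h
      have hp := List.mem_range.1 hp
      obtain ⟨y, -, hy⟩ := hpick i p (by
        rw [his]
        refine List.mem_append_left _ (List.mem_map_of_mem (f := fun p => [p]) ?_)
        simp [hI, hp, hx])
      have := hτeq i hi _ hy
      dsimp only at this
      exact List.mem_map.2 ⟨_, hy, this⟩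
    · obtain ⟨y, hy, rfl⟩ := List.mem_map.1 h
      rw [hτeq i hi y hy]
      exact List.mem_map_of_mem (List.mem_range.2 (hlt i y hy))

end Correct

/-! ## From independent sets to clauses -/

/-- The relation of a clause that forbids two ones (`true`) or two zeros (`false`). -/
def clauseRel (b : Bool) : BoolRel 2 := (symRel 2 {1, 2}).shift fun _ => b

lemma clauseRel_mem (b : Bool) : clauseRel b ∈ twoSAT := ⟨fun _ => b, rfl⟩

lemma mem_clauseRel {b : Bool} {t : Fin 2 → Bool} :
    t ∈ clauseRel b ↔ ¬ (t 0 = b ∧ t 1 = b) := by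
  have h : ∀ t : Fin 2 → Bool, t ∈ symRel 2 {1, 2} ↔ ¬ (t 0 = false ∧ t 1 = false) := by
    intro t
    simp only [symRel, Set.mem_ofPred_eq, Set.mem_insert_iff, Set.mem_singleton_iff,
      Fin.univ_succ]
    cases h0 : t 0 <;> cases h1 : t 1 <;> simp [Finset.filter_insert, Finset.filter_singleton, h0, h1]
  have h' : t ∈ clauseRel b ↔ (fun i => xor (t i) b) ∈ symRel 2 {1, 2} := by
    constructor
    · rintro ⟨s, hs, rfl⟩
      simpa using hs
    · intro hs
      exact ⟨_, hs, by simp⟩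
  rw [h', h]
  cases b <;> cases t 0 <;> cases t 1 <;> simp

/-- Clauses with scope `(i, j)` and relation `clauseRel b`. -/
abbrev Clause := (ℕ × ℕ) × Bool

/-- The instance given by a list of clauses; the clauses with the relation `clauseRel true` form
the proposed set of satisfied clauses. -/
def instOf (n : ℕ) (l : List Clause) (h : ∀ c ∈ l, c.1.1 < n ∧ c.1.2 < n) (k : ℕ) :
    ImproveInstance twoSAT where
  csp :=
    { numVars := n
      numClauses := l.length
      scope := fun j => ![⟨l[j].1.1, (h _ (List.getElem_mem _)).1⟩,
        ⟨l[j].1.2, (h _ (List.getElem_mem _)).2⟩]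
      rel := fun j => clauseRel l[j].2
      rel_mem := fun j => clauseRel_mem _ }
  k := k
  P := Finset.univ.filter fun j : Fin l.length => l[j].2 = true

/-- Clauses in the form in which they are encoded. -/
noncomputable def clauseCode (c : Clause) : List ℕ × Data × Bool :=
  -- Only two truth tables occur, and a program can hold both as constants.
  ([c.1.1, c.1.2], if c.2 = true then (clauseRel true).enc else (clauseRel false).enc, c.2)

@[fun_prop]
theorem Poly.clauseCode {γ : Type} [Enc γ] {f : γ → Clause} (hf : Poly f) :
    Poly fun x => clauseCode (f x) := by
  unfold ParamCSP.clauseCode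
  fun_prop

lemma ofList_ofFn {α : Type} (l : List α) (f : Fin l.length → Data) (g : α → Data)
    (h : ∀ j, f j = g l[j]) : Data.ofList (List.ofFn f) = Data.ofList (l.map g) := by
  congr 1
  refine List.ext_getElem (by simp) fun i h1 h2 => ?_
  simp [h]

lemma mem_instOf_P {n : ℕ} {l : List Clause} {h : ∀ c ∈ l, c.1.1 < n ∧ c.1.2 < n} {k : ℕ}
    (j : Fin l.length) : j ∈ (instOf n l h k).P ↔ l[j].2 = true := by
  change j ∈ Finset.univ.filter (fun j : Fin l.length => l[j].2 = true) ↔ _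
  simp

/-- Turns the encoding of a dependent structure into that of a plain triple, to which `Poly`
applies. -/
lemma instOf_enc (n : ℕ) (l : List Clause) (h : ∀ c ∈ l, c.1.1 < n ∧ c.1.2 < n) (k : ℕ) :
    (instOf n l h k).enc = enc (n, l.map clauseCode, k) := by
  simp only [ImproveInstance.enc, enc_prod]
  congr 1
  congr 1
  change Data.ofList (List.ofFn _) = Data.ofList ((l.map clauseCode).map enc)
  rw [List.map_map]
  refine ofList_ofFn l _ _ fun j => ?_
  have h1 := mem_instOf_P (h := h) (k := k) j
  refine congrArg₂ Data.cons rfl (congrArg₂ Data.cons ?_ (congrArg Data.ofBool ?_))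
  · change (clauseRel l[j].2).enc = if l[j].2 = true then _ else _
    cases l[j].2 <;> rfl
  · rw [Bool.eq_iff_iff]
    exact (@decide_eq_true_iff _ (_)).trans h1

lemma instOf_isSimple (n : ℕ) (l : List Clause) (h : ∀ c ∈ l, c.1.1 < n ∧ c.1.2 < n) (k : ℕ)
    (hl : l.Nodup) : (instOf n l h k).csp.IsSimple := by
  intro (i : Fin l.length) (j : Fin l.length) hij
  simp only [instOf, Prod.mk.injEq] at hij
  obtain ⟨h1, h2⟩ := hij
  have h3 := congrFun h1 0
  have h4 := congrFun h1 1
  simp only [Matrix.cons_val_zero, Matrix.cons_val_one, Fin.mk.injEq] at h3 h4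
  -- The relation determines its bit: the constant pair `b` is the only one excluded by `clauseRel
  -- b`.
  have h5 : l[i].2 = l[j].2 := by
    have : (fun _ => l[i].2) ∉ clauseRel l[j].2 := by
      rw [← h2, mem_clauseRel]; simp
    simpa [mem_clauseRel] using this
  have h6 : l[i] = l[j] := Prod.ext (Prod.ext h3 h4) h5
  exact Fin.ext ((List.Nodup.getElem_inj_iff hl).1 h6)

/-- Whether a valuation satisfies a clause. -/
def Clause.sat (f : ℕ → Bool) (c : Clause) : Bool := (f c.1.1 != c.2) || (f c.1.2 != c.2)

/-- Whether a valuation violates a clause that forbids two ones. -/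
def Clause.clash (f : ℕ → Bool) (c : Clause) : Bool := c.2 && (f c.1.1 && f c.1.2)

/-- Whether a valuation satisfies a clause that forbids two zeros. -/
def Clause.gain (f : ℕ → Bool) (c : Clause) : Bool := !c.2 && (f c.1.1 || f c.1.2)

lemma card_filter_fin {α : Type} (l : List α) (p : α → Bool) :
    (Finset.univ.filter fun j : Fin l.length => p l[j] = true).card = (l.filter p).length := by
  have h : (Finset.univ.filter fun j : Fin l.length => p l[j] = true).card =
      ((List.finRange l.length).filter fun j => p l[j]).length := by
    rw [← List.toFinset_card_of_nodup ((List.nodup_finRange _).filter _)]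
    congr 1
    ext j
    simp
  rw [h, ← List.length_map (f := fun j : Fin l.length => l[j])]
  conv_rhs => rw [← List.map_getElem_finRange l, List.filter_map]
  rfl

/-- A clause forbidding two ones is satisfied unless it clashes; a clause forbidding two zeros is
satisfied iff it gains. Written additively to avoid truncated subtraction. -/
lemma sat_add_clash (f : ℕ → Bool) (l : List Clause) :
    (l.filter (Clause.sat f)).length + (l.filter (Clause.clash f)).length =
      (l.filter fun c => c.2).length + (l.filter (Clause.gain f)).length := by
  induction l with
  | nil => rfl
  | cons c l ih =>
    obtain ⟨⟨i, j⟩, b⟩ := c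
    simp only [List.filter_cons, Clause.sat, Clause.clash, Clause.gain] at ih ⊢
    cases b <;> rcases Bool.eq_false_or_eq_true (f i) with hi | hi <;>
      rcases Bool.eq_false_or_eq_true (f j) with hj | hj <;> simp [hi, hj] <;> omega

/-- The valuation of the natural numbers given by a list of truth values. -/
def valOf (a : List Bool) (i : ℕ) : Bool := a.getD i false

section Instance
variable {n : ℕ} {l : List Clause} {h : ∀ c ∈ l, c.1.1 < n ∧ c.1.2 < n} {k : ℕ}

lemma valOf_ofFn (α : Fin n → Bool) (i : Fin n) : valOf (List.ofFn α) i = α i := by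
  simp [valOf]

open Classical in
lemma mem_satisfied_instOf (α : Fin n → Bool) (j : Fin l.length) :
    j ∈ (instOf n l h k).csp.satisfied α ↔ Clause.sat (valOf (List.ofFn α)) l[j] = true := by
  have h0 : j ∈ (instOf n l h k).csp.satisfied α ↔
      (fun i => α ((instOf n l h k).csp.scope j i)) ∈ clauseRel l[j].2 := by
    unfold CSPInstance.satisfied
    exact Finset.mem_filter.trans (and_iff_right (Finset.mem_univ (α := Fin l.length) j))
  have h1 := valOf_ofFn α ⟨l[j].1.1, (h _ (List.getElem_mem _)).1⟩
  have h2 := valOf_ofFn α ⟨l[j].1.2, (h _ (List.getElem_mem _)).2⟩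
  dsimp only at h1 h2
  rw [h0, mem_clauseRel]
  simp only [Clause.sat, h1, h2, instOf]
  simp [imp_iff_not_or]

lemma card_satisfied (α : Fin n → Bool) :
    ((instOf n l h k).csp.satisfied α).card =
      (l.filter (Clause.sat (valOf (List.ofFn α)))).length := by
  rw [← card_filter_fin l]
  congr 1
  ext (j : Fin l.length)
  exact (mem_satisfied_instOf α j).trans
    ((Finset.mem_filter (p := fun j : Fin l.length => Clause.sat (valOf (List.ofFn α)) l[j] = true)
      ).trans (and_iff_right (Finset.mem_univ j))).symm

/-- Without clashes all of `P` is satisfied, so the difference consists of the satisfied clauses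
outside `P`. -/
lemma card_symmDiff_satisfied (α : Fin n → Bool)
    (hα : ∀ c ∈ l, Clause.clash (valOf (List.ofFn α)) c = false) :
    (symmDiff ((instOf n l h k).csp.satisfied α) (instOf n l h k).P).card =
      (l.filter (Clause.gain (valOf (List.ofFn α)))).length := by
  rw [← card_filter_fin l]
  congr 1
  ext (j : Fin l.length)
  have h1 := hα l[j] (List.getElem_mem _)
  have h2 : j ∈ symmDiff ((instOf n l h k).csp.satisfied α) (instOf n l h k).P ↔ _ :=
    Finset.mem_symmDiff.trans (or_congr
      (and_congr (mem_satisfied_instOf α j) (not_congr (mem_instOf_P j)))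
      (and_congr (mem_instOf_P j) (not_congr (mem_satisfied_instOf α j))))
  refine h2.trans (Iff.trans ?_ (Finset.mem_filter.trans
    (and_iff_right (Finset.mem_univ j))).symm)
  clear h2
  generalize l[j] = c at h1
  obtain ⟨⟨i, j⟩, b⟩ := c
  simp only [Clause.sat, Clause.clash, Clause.gain] at h1 ⊢
  generalize valOf (List.ofFn α) i = x at h1
  generalize valOf (List.ofFn α) j = y at h1
  revert b x y
  decide

end Instance

/-- The edges of the conflict graph. -/
def edges (V : List View) : List (ℕ × ℕ) :=
  ((List.range V.length).flatMap fun i => (List.range V.length).map fun j => (i, j)).filter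
    fun p => !decide (p.1 = p.2) &&
      (V.getD p.1 ([], [], [])).conflict (V.getD p.2 ([], [], []))

/-- The clauses that express the independent set problem for the conflict graph. -/
def clauses (V : List View) : List Clause :=
  ((edges V).map fun p => (p, true)) ++ (List.range V.length).map fun i => ((i, i), false)

@[fun_prop]
theorem Poly.clauses {γ : Type} [Enc γ] {V : γ → List View} (hV : Poly V) :
    Poly fun x => clauses (V x) := by
  unfold ParamCSP.clauses edges
  fun_prop

/-- The test whether an assignment certifies an independent set of size `N`. -/
def test (l : List Clause) (N : ℕ) (a : List Bool) : Bool :=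
  decide ((l.filter fun c => Clause.clash (valOf a) c).length + N ≤
    (l.filter fun c => Clause.gain (valOf a) c).length)

@[fun_prop]
theorem Poly.test {γ : Type} [Enc γ] {l : γ → List Clause} {N : γ → ℕ} {a : γ → List Bool}
    (hl : Poly l) (hN : Poly N) (ha : Poly a) : Poly fun x => test (l x) (N x) (a x) := by
  unfold ParamCSP.test Clause.clash Clause.gain valOf
  fun_prop

lemma mem_edges {V : List View} {p : ℕ × ℕ} : p ∈ edges V ↔
    ∃ i j : Fin V.length, p = (i.1, j.1) ∧ i ≠ j ∧ V[i].conflict V[j] = true := by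
  simp only [edges, List.mem_filter, List.mem_flatMap, List.mem_map, List.mem_range,
    Bool.and_eq_true, Bool.not_eq_true', decide_eq_false_iff_not]
  constructor
  · rintro ⟨⟨i, hi, j, hj, rfl⟩, h1, h2⟩
    rw [List.getD_eq_getElem _ _ hi, List.getD_eq_getElem _ _ hj] at h2
    exact ⟨⟨i, hi⟩, ⟨j, hj⟩, rfl, fun h => h1 (congrArg Fin.val h), h2⟩
  · rintro ⟨i, j, rfl, h1, h2⟩
    refine ⟨⟨i, i.2, j, j.2, rfl⟩, fun h => h1 (Fin.ext h), ?_⟩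
    rw [List.getD_eq_getElem _ _ i.2, List.getD_eq_getElem _ _ j.2]
    exact h2

lemma clauses_lt (V : List View) : ∀ c ∈ clauses V, c.1.1 < V.length ∧ c.1.2 < V.length := by
  intro c hc
  rcases List.mem_append.1 hc with hc | hc
  · obtain ⟨p, hp, rfl⟩ := List.mem_map.1 hc
    obtain ⟨i, j, rfl, -⟩ := mem_edges.1 hp
    exact ⟨i.2, j.2⟩
  · obtain ⟨i, hi, rfl⟩ := List.mem_map.1 hc
    exact ⟨List.mem_range.1 hi, List.mem_range.1 hi⟩

lemma nodup_clauses (V : List View) : (clauses V).Nodup := by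
  refine List.Nodup.append ?_ ?_ ?_
  · refine List.Nodup.map (fun a b h => (Prod.mk.inj h).1) (List.Nodup.filter _ ?_)
    exact List.Nodup.product List.nodup_range List.nodup_range
  · exact List.nodup_range.map fun a b h => (Prod.mk.inj (Prod.mk.inj h).1).1
  · intro c h1 h2
    obtain ⟨p, -, rfl⟩ := List.mem_map.1 h1
    obtain ⟨i, -, h⟩ := List.mem_map.1 h2
    simp at h

lemma gain_clauses (V : List View) (f : ℕ → Bool) :
    ((clauses V).filter (Clause.gain f)).length =
      (Finset.univ.filter fun i : Fin V.length => f i = true).card := by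
  have h1 : (((edges V).map fun p => (p, true)).filter (Clause.gain f)) = [] := by
    rw [List.filter_eq_nil_iff]
    intro c hc
    obtain ⟨p, -, rfl⟩ := List.mem_map.1 hc
    simp [Clause.gain]
  have h2 : (Finset.univ.filter fun i : Fin V.length => f i = true).card =
      ((List.range V.length).filter f).length := by
    rw [← List.toFinset_card_of_nodup (List.nodup_range.filter _),
      ← Finset.card_map Fin.valEmbedding]
    congr 1
    ext i
    simp only [Finset.mem_map, Finset.mem_filter, Finset.mem_univ, true_and, Fin.valEmbedding_apply,
      List.mem_toFinset, List.mem_filter, List.mem_range]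
    constructor
    · rintro ⟨j, hj, rfl⟩
      exact ⟨j.2, hj⟩
    · rintro ⟨h1, h2⟩
      exact ⟨⟨i, h1⟩, h2, rfl⟩
  rw [clauses, List.filter_append, h1, List.nil_append, List.filter_map, List.length_map, h2]
  congr 2
  funext i
  simp [Clause.gain]

lemma clash_clauses (V : List View) (f : ℕ → Bool) :
    ((clauses V).filter (Clause.clash f)).length =
      ((edges V).filter fun p => f p.1 && f p.2).length := by
  have h1 : (((List.range V.length).map fun i => ((i, i), false)).filter (Clause.clash f)) = [] := by
    rw [List.filter_eq_nil_iff]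
    intro c hc
    obtain ⟨p, -, rfl⟩ := List.mem_map.1 hc
    simp [Clause.clash]
  rw [clauses, List.filter_append, h1, List.append_nil, List.filter_map, List.length_map]
  congr 2

/-- The instance of the improvement problem that asks for an independent set of views. -/
def viewInst (V : List View) (N : ℕ) : ImproveInstance twoSAT :=
  instOf V.length (clauses V) (clauses_lt V) N

/-- By `sat_add_clash` the test says that `α` satisfies at least `N` clauses more than `P` contains.
An independent set of size `N` forces this on any correct answer. Without such a set the test must
fail even though the promise may be violated, and there the deletion argument is used. -/
theorem test_iff {V : List View} {N : ℕ} {α : Fin V.length → Bool}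
    (hα : (improveMaxCSP twoSAT).Correct (viewInst V N) α) :
    test (clauses V) N (List.ofFn α) = true ↔
      ∃ S : Finset (Fin V.length), (∀ i ∈ S, ∀ j ∈ S, i ≠ j → V[i].conflict V[j] = false) ∧
        N ≤ S.card := by
  have hcount := sat_add_clash (valOf (List.ofFn α)) (clauses V)
  simp only [test, decide_eq_true_eq]
  constructor
  · intro h
    rw [gain_clauses, clash_clauses] at h
    set B := (edges V).filter fun p => valOf (List.ofFn α) p.1 && valOf (List.ofFn α) p.2 with hB
    set S₀ := Finset.univ.filter fun i : Fin V.length => valOf (List.ofFn α) i = true with hS₀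
    -- Drop the first endpoint of every violated edge clause: at most one vertex for each clash.
    refine ⟨S₀.filter fun i => ∀ p ∈ B, p.1 ≠ i.1, ?_, ?_⟩
    · intro i hi j hj hij
      by_contra hc
      rw [Bool.not_eq_false] at hc
      rw [Finset.mem_filter] at hi hj
      refine hi.2 (i.1, j.1) (List.mem_filter.2 ⟨mem_edges.2 ⟨i, j, rfl, hij, hc⟩, ?_⟩) rfl
      simp only [hS₀, Finset.mem_filter, Finset.mem_univ, true_and] at hi hj
      simp [hi.1, hj.1]
    · have h1 : S₀.card ≤ (S₀.filter fun i => ∀ p ∈ B, p.1 ≠ i.1).card +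
          (S₀.filter fun i => ¬ ∀ p ∈ B, p.1 ≠ i.1).card := by
        rw [Finset.card_filter_add_card_filter_not]
      have h2 : (S₀.filter fun i => ¬ ∀ p ∈ B, p.1 ≠ i.1).card ≤ B.length := by
        rw [← List.length_map (as := B) (f := fun p => p.1)]
        refine le_trans ?_ (List.toFinset_card_le _)
        refine Finset.card_le_card_of_injOn (fun i => i.1) ?_ (fun i _ j _ h => Fin.ext h)
        intro i hi
        have hi := (Finset.mem_filter.1 hi).2
        push Not at hi
        obtain ⟨p, hp, hpi⟩ := hi
        simp only [List.coe_toFinset, Set.mem_ofPred_eq, List.mem_map]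
        exact ⟨p, hp, hpi⟩
      omega
  · rintro ⟨S, hS, hN⟩
    -- A larger set would lie at distance more than `N` from `P`, so `S` is cut down to exactly `N`
    -- elements.
    obtain ⟨S', hS', hN'⟩ := Finset.exists_subset_card_eq hN
    let β : Fin V.length → Bool := fun i => decide (i ∈ S')
    have hβ : ∀ i : Fin V.length, valOf (List.ofFn β) i = true ↔ i ∈ S' := fun i => by
      rw [valOf_ofFn]; simp [β]
    have hedge : (edges V).filter (fun p => valOf (List.ofFn β) p.1 && valOf (List.ofFn β) p.2) =
        [] := by
      rw [List.filter_eq_nil_iff]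
      intro p hp
      obtain ⟨i, j, rfl, hij, hc⟩ := mem_edges.1 hp
      simp only [Bool.and_eq_true, hβ]
      rintro ⟨hi, hj⟩
      rw [hS i (hS' hi) j (hS' hj) hij] at hc
      simp at hc
    have hclash : ((clauses V).filter (Clause.clash (valOf (List.ofFn β)))) = [] := by
      apply List.eq_nil_of_length_eq_zero
      rw [clash_clauses, hedge]
      rfl
    have hgain : ((clauses V).filter (Clause.gain (valOf (List.ofFn β)))).length = N := by
      rw [gain_clauses, ← hN']
      congr 1
      ext i
      simp [hβ]
    have h1 : ((viewInst V N).csp.satisfied β).card ≤ ((viewInst V N).csp.satisfied α).card :=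
      hα β (((card_symmDiff_satisfied β fun c hc => by
        simpa using List.filter_eq_nil_iff.1 hclash c hc).trans hgain).le)
    have hcount' := sat_add_clash (valOf (List.ofFn β)) (clauses V)
    rw [hclash, hgain] at hcount'
    have h2 : ((viewInst V N).csp.satisfied β).card = _ := card_satisfied β
    have h3 : ((viewInst V N).csp.satisfied α).card = _ := card_satisfied α
    rw [h2, h3] at h1
    simp only [List.length_nil] at hcount'
    change (List.filter (Clause.clash (valOf (List.ofFn α))) (clauses V)).length + N ≤
      (List.filter (Clause.gain (valOf (List.ofFn α))) (clauses V)).length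
    omega

/-- A global maximizer is correct whether or not the promise holds. -/
lemma exists_correct (J : ImproveInstance twoSAT) : ∃ α, (improveMaxCSP twoSAT).Correct J α := by
  obtain ⟨α, hα⟩ := Finite.exists_max fun α : Fin J.csp.numVars → Bool => (J.csp.satisfied α).card
  exact ⟨α, fun β _ => hα β⟩

/-! ## Circuits as lists of gates -/

/-- The kind of a gate. -/
def Gate.kind {n : ℕ} : Gate n → ℕ
  | input => 0
  | not _ => 1
  | and _ => 2
  | or _ => 3

/-- The list of gates of a circuit. -/
def Circuit.net (C : Circuit) : Net :=
  List.ofFn fun i => ((C.gate i).kind, (C.gate i).preds.map fun a => a.1)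

/-- The number encoded by a tree. -/
def toNat (d : Data) : ℕ := d.toList.length

lemma toNat_ofNat (n : ℕ) : toNat (.ofNat n) = n := by
  induction n with
  | zero => rfl
  | succ n ih => simpa [toNat, Data.ofNat, Data.toList] using ih

/-- Reads a gate. -/
def decodeGate (d : Data) : ℕ × List ℕ :=
  -- A negation stores its predecessor as a bare number, the other gates store a list.
  (toNat d.head, if toNat d.head = 1 then [toNat d.tail] else d.tail.toList.map fun x => toNat x)

/-- Reads a circuit. -/
def decodeNet (d : Data) : Net := d.head.toList.map fun x => decodeGate x

@[fun_prop]
theorem Poly.toNat {γ : Type} [Enc γ] {d : γ → Data} (hd : Poly d) : Poly fun c => toNat (d c) := by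
  unfold ParamCSP.toNat
  fun_prop

@[fun_prop]
theorem Poly.decodeNet {γ : Type} [Enc γ] {d : γ → Data} (hd : Poly d) :
    Poly fun c => decodeNet (d c) := by
  unfold ParamCSP.decodeNet decodeGate
  fun_prop

lemma toList_ofList (l : List Data) : (Data.ofList l).toList = l := by
  induction l with
  | nil => rfl
  | cons a l ih => simp [Data.ofList, Data.toList, ih]

lemma decodeGate_enc {n : ℕ} (g : Gate n) :
    decodeGate g.enc = (g.kind, g.preds.map fun a => a.1) := by
  cases g <;>
    simp [decodeGate, Gate.enc, Gate.kind, Gate.preds, Data.head, Data.tail, toNat_ofNat,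
      toList_ofList, Data.toList, Function.comp_def] <;>
    exact List.map_eq_flatMap.symm

lemma decodeNet_enc (C : Circuit) : decodeNet C.enc = C.net := by
  simp [decodeNet, Circuit.enc, Data.head, toList_ofList, Circuit.net, List.map_ofFn,
    Function.comp_def, decodeGate_enc]

/-! ### Certificates for circuits of weft at most one -/

namespace Circuit
variable {C : Circuit}

lemma net_getD (i : Fin C.size) :
    C.net.getD i (0, []) = ((C.gate i).kind, (C.gate i).preds.map fun a => a.1) := by
  rw [List.getD_eq_getElem _ _ (by simp [net])]
  simp [net]

lemma le_foldr_max {l : List ℕ} {x : ℕ} (h : x ∈ l) : x ≤ l.foldr max 0 := by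
  induction l with
  | nil => simp at h
  | cons a l ih =>
    rcases List.mem_cons.1 h with rfl | h
    · exact le_max_left _ _
    · exact (ih h).trans (le_max_right _ _)

lemma depthAt_lt {i : Fin C.size} {a : Fin i.1} (h : a ∈ (C.gate i).preds) :
    C.depthAt ⟨a, a.2.trans i.2⟩ < C.depthAt i := by
  conv_rhs => rw [depthAt]
  exact le_foldr_max (List.mem_map_of_mem
    (f := fun a : Fin i.1 => C.depthAt ⟨a, a.2.trans i.2⟩ + 1) h)

lemma weftAt_add_le {i : Fin C.size} {a : Fin i.1} (h : a ∈ (C.gate i).preds) :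
    C.weftAt ⟨a, a.2.trans i.2⟩ + (if (C.gate i).IsLarge then 1 else 0) ≤ C.weftAt i := by
  conv_rhs => rw [weftAt]
  exact Nat.add_le_add_right (le_foldr_max (List.mem_map_of_mem
    (f := fun a : Fin i.1 => C.weftAt ⟨a, a.2.trans i.2⟩) h)) _

lemma weftAt_le {i : Fin C.size} {a : Fin i.1} (h : a ∈ (C.gate i).preds) :
    C.weftAt ⟨a, a.2.trans i.2⟩ ≤ C.weftAt i :=
  (Nat.le_add_right _ _).trans (weftAt_add_le h)

lemma not_isLarge {i : Fin C.size} (h : C.weftAt i = 0) : ¬ (C.gate i).IsLarge := by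
  intro hl
  rw [weftAt, if_pos hl] at h
  omega

lemma preds_of_kind {n : ℕ} {g : Gate n} (h : g.kind = 0) : g.preds = [] := by
  cases g <;> simp_all [Gate.kind, Gate.preds]

lemma weftAt_of_kind {i : Fin C.size} (h : (C.gate i).kind = 0) : C.weftAt i = 0 := by
  have : ¬ (C.gate i).IsLarge := by
    unfold Gate.IsLarge
    simp [preds_of_kind h]
  rw [weftAt, if_neg this, preds_of_kind h]
  rfl

lemma val_eq (T : Finset (Fin C.size)) (i : Fin C.size) : C.val T i =
    if (C.gate i).kind = 0 then decide (i ∈ T)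
    else if (C.gate i).kind = 1 then (C.gate i).preds.all fun a => !C.val T ⟨a, a.2.trans i.2⟩
    else if (C.gate i).kind = 2 then (C.gate i).preds.all fun a => C.val T ⟨a, a.2.trans i.2⟩
    else (C.gate i).preds.any fun a => C.val T ⟨a, a.2.trans i.2⟩ := by
  rw [val]
  cases C.gate i <;> simp [Gate.kind, Gate.preds]

/-- The set of gates given by a list of numbers. -/
def gateSet (C : Circuit) (K : List ℕ) : Finset (Fin C.size) := Finset.univ.filter fun i => i.1 ∈ K

lemma ev_net (d : ℕ) (K : List ℕ) (i : Fin C.size) (hd : C.depthAt i < d) :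
    ev d C.net K i = C.val (C.gateSet K) i := by
  induction d generalizing i with
  | zero => omega
  | succ d ih =>
    have h : ∀ a ∈ (C.gate i).preds, ev d C.net K a.1 =
        C.val (C.gateSet K) ⟨a, a.2.trans i.2⟩ := fun a ha =>
      ih ⟨a, a.2.trans i.2⟩ (by have := depthAt_lt ha; omega)
    rw [ev, net_getD, val_eq]
    simp only [List.all_map, List.any_map]
    split_ifs
    · simp [gateSet]
    all_goals
      rw [Bool.eq_iff_iff]
      simp only [List.all_eq_true, List.any_eq_true, Function.comp]
    · exact forall₂_congr fun a ha => by rw [h a ha]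
    · exact forall₂_congr fun a ha => by rw [h a ha]
    · exact exists_congr fun a => and_congr_right fun ha => by rw [h a ha]

/-- A gate of weft zero has only gates of fan-in at most two below it, so each level at most doubles
the number of inputs. -/
lemma length_ins (d : ℕ) (i : Fin C.size) (hw : C.weftAt i = 0) :
    (ins d C.net i).length ≤ 2 ^ d := by
  induction d generalizing i with
  | zero => simp [ins]
  | succ d ih =>
    rw [ins, net_getD]
    dsimp only
    split_ifs
    · simpa using Nat.one_le_two_pow
    · have h1 : ∀ a ∈ (C.gate i).preds, (ins d C.net a.1).length ≤ 2 ^ d := fun a ha =>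
        ih ⟨a, a.2.trans i.2⟩ (by have := weftAt_le ha; omega)
      have h2 : ¬ 2 < (C.gate i).preds.length := not_isLarge hw
      rw [List.flatMap_map, List.length_flatMap]
      refine (List.sum_le_card_nsmul _ (2 ^ d) ?_).trans ?_
      · intro x hx
        obtain ⟨a, ha, rfl⟩ := List.mem_map.1 hx
        exact h1 a ha
      · rw [List.length_map, smul_eq_mul, pow_succ, mul_comm]
        exact Nat.mul_le_mul_left _ (by omega)

/-- Whether a condition on the value of a gate holds. -/
def Holds (C : Circuit) (T : Finset (Fin C.size)) (c : ℕ × Bool) : Prop :=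
  ∃ h : c.1 < C.size, C.val T ⟨c.1, h⟩ = c.2

lemma mem_mulCat {α : Type} {X Y : List (List α)} {z : List α} :
    z ∈ mulCat X Y ↔ ∃ x ∈ X, ∃ y ∈ Y, x ++ y = z := by
  simp [mulCat]

/-- The expansion ends at input gates or at a large gate that needs all its predecessors. In the
latter case the large gate uses up the weft, and its predecessors have weft zero. -/
lemma certs_wf (d : ℕ) (i : Fin C.size) (b : Bool) (hd : C.depthAt i < d) (hw : C.weftAt i ≤ 1) :
    ∀ e ∈ certs d C.net i b, ∀ c ∈ e, ∃ h : c.1 < C.size,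
      C.weftAt ⟨c.1, h⟩ = 0 ∧ C.depthAt ⟨c.1, h⟩ < d := by
  induction d generalizing i b with
  | zero => omega
  | succ d ih =>
    have key : ∀ a ∈ (C.gate i).preds, ∀ b, ∀ e ∈ certs d C.net a b, ∀ c ∈ e,
        ∃ h : c.1 < C.size, C.weftAt ⟨c.1, h⟩ = 0 ∧ C.depthAt ⟨c.1, h⟩ < d + 1 := by
      intro a ha b e he c hc
      obtain ⟨h, h1, h2⟩ := ih ⟨a, a.2.trans i.2⟩ b (by have := depthAt_lt ha; omega)
        ((weftAt_le ha).trans hw) e he c hc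
      exact ⟨h, h1, by omega⟩
    have key' : ∀ b, ∀ e ∈ (C.gate i).preds.flatMap (fun a : Fin i.1 => certs d C.net a.1 b), ∀ c ∈ e,
        ∃ h : c.1 < C.size, C.weftAt ⟨c.1, h⟩ = 0 ∧ C.depthAt ⟨c.1, h⟩ < d + 1 := by
      intro b e he
      obtain ⟨a, ha, he⟩ := List.mem_flatMap.1 he
      exact key a ha b e he
    rw [certs, net_getD]
    dsimp only
    rw [List.flatMap_map, List.flatMap_map, List.map_map, List.map_map]
    split_ifs with h0 h1 h2 h3
    · simp only [List.mem_singleton, forall_eq]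
      exact ⟨i.2, weftAt_of_kind h0, hd⟩
    · exact key' _
    · simp only [List.mem_singleton, forall_eq, List.mem_map]
      rintro _ ⟨a, ha, rfl⟩
      refine ⟨a.2.trans i.2, ?_, (depthAt_lt ha).trans hd⟩
      have := weftAt_add_le ha
      rw [if_pos (by simpa [Gate.IsLarge] using h3)] at this
      dsimp only [Function.comp]
      omega
    · have hget : ∀ j, ∀ e ∈ ((C.gate i).preds.map
          ((fun a => certs d C.net a b) ∘ fun a => a.1)).getD j [[]], ∀ c ∈ e,
            ∃ h : c.1 < C.size, C.weftAt ⟨c.1, h⟩ = 0 ∧ C.depthAt ⟨c.1, h⟩ < d + 1 := by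
        intro j e he
        rcases lt_or_ge j (C.gate i).preds.length with hj | hj
        · rw [List.getD_eq_getElem _ _ (by simpa using hj), List.getElem_map] at he
          exact key _ (List.getElem_mem hj) b e he
        · rw [List.getD_eq_default _ _ (by simpa using hj)] at he
          simp [List.mem_singleton.1 he]
      intro e he c hc
      obtain ⟨x, hx, y, hy, rfl⟩ := mem_mulCat.1 he
      rcases List.mem_append.1 hc with hc | hc
      exacts [hget 0 x hx c hc, hget 1 y hy c hc]
    · exact key' _

lemma exists_mem_mulCat {α : Type} {X Y : List (List α)} {P : α → Prop} :
    (∃ e ∈ mulCat X Y, ∀ c ∈ e, P c) ↔ (∃ e ∈ X, ∀ c ∈ e, P c) ∧ ∃ e ∈ Y, ∀ c ∈ e, P c := by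
  constructor
  · rintro ⟨e, he, h⟩
    obtain ⟨x, hx, y, hy, rfl⟩ := mem_mulCat.1 he
    exact ⟨⟨x, hx, fun c hc => h c (List.mem_append_left _ hc)⟩,
      ⟨y, hy, fun c hc => h c (List.mem_append_right _ hc)⟩⟩
  · rintro ⟨⟨x, hx, h⟩, ⟨y, hy, h'⟩⟩
    refine ⟨x ++ y, mem_mulCat.2 ⟨x, hx, y, hy, rfl⟩, fun c hc => ?_⟩
    rcases List.mem_append.1 hc with hc | hc
    exacts [h c hc, h' c hc]

/-- With fan-in at most two, entries 0 and 1 exhaust the list. A missing entry defaults to `[[]]`,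
whose only member imposes no condition. -/
lemma exists_mem_mulCat_getD {α β : Type} {l : List β} {F : β → List (List α)} {P : α → Prop}
    (hl : ¬ 2 < l.length) :
    (∃ e ∈ mulCat ((l.map F).getD 0 [[]]) ((l.map F).getD 1 [[]]), ∀ c ∈ e, P c) ↔
      ∀ a ∈ l, ∃ e ∈ F a, ∀ c ∈ e, P c := by
  rw [exists_mem_mulCat]
  match l, hl with
  | [], _ => simp
  | [a], _ => simp
  | [a, b], _ => simp
  | _ :: _ :: _ :: _, hl => simp at hl

lemma exists_preds_eq_singleton {n : ℕ} {g : Gate n} (h : g.kind = 1) : ∃ a, g.preds = [a] := by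
  cases g <;> simp_all [Gate.kind, Gate.preds]

lemma val_iff_certs (d : ℕ) (T : Finset (Fin C.size)) (i : Fin C.size) (b : Bool)
    (hd : C.depthAt i < d) :
    C.val T i = b ↔ ∃ e ∈ certs d C.net i b, ∀ c ∈ e, C.Holds T c := by
  induction d generalizing i b with
  | zero => omega
  | succ d ih =>
    have key : ∀ b, (∃ e ∈ (C.gate i).preds.flatMap (fun a : Fin i.1 => certs d C.net a.1 b),
        ∀ c ∈ e, C.Holds T c) ↔ ∃ a ∈ (C.gate i).preds, C.val T ⟨a, a.2.trans i.2⟩ = b := by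
      intro b
      simp only [List.mem_flatMap]
      constructor
      · rintro ⟨e, ⟨a, ha, he⟩, h⟩
        exact ⟨a, ha, (ih ⟨a, a.2.trans i.2⟩ b (by have := depthAt_lt ha; omega)).2 ⟨e, he, h⟩⟩
      · rintro ⟨a, ha, h⟩
        obtain ⟨e, he, h⟩ := (ih ⟨a, a.2.trans i.2⟩ b (by have := depthAt_lt ha; omega)).1 h
        exact ⟨e, ⟨a, ha, he⟩, h⟩
    have hv := val_eq T i
    rw [certs, net_getD]
    dsimp only
    rw [List.flatMap_map, List.flatMap_map, List.map_map, List.map_map]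
    by_cases h0 : (C.gate i).kind = 0
    · rw [if_pos h0]
      simp only [List.mem_singleton, exists_eq_left, forall_eq, Holds]
      exact ⟨fun h => ⟨i.2, h⟩, fun ⟨_, h⟩ => h⟩
    rw [if_neg h0] at hv ⊢
    by_cases h1 : (C.gate i).kind = 1
    · rw [if_pos h1] at hv ⊢
      obtain ⟨a, ha⟩ := exists_preds_eq_singleton h1
      rw [key, hv, ha]
      simp only [List.all_cons, List.all_nil, Bool.and_true, List.mem_singleton, exists_eq_left]
      cases C.val T ⟨a.1, a.2.trans i.2⟩ <;> cases b <;> simp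
    rw [if_neg h1] at hv ⊢
    -- The remaining gates are conjunctions and disjunctions. If the gate is a conjunction exactly
    -- when `b` is true, all predecessors need the value `b`; otherwise one suffices.
    by_cases h2 : decide ((C.gate i).kind = 2) = b
    · have hall : C.val T i = b ↔ ∀ a ∈ (C.gate i).preds, C.val T ⟨a.1, a.2.trans i.2⟩ = b := by
        rw [hv, ← h2]
        by_cases h : (C.gate i).kind = 2 <;> simp [h]
      rw [if_pos h2, hall]
      split_ifs with h3
      · simp only [List.mem_singleton, exists_eq_left, List.mem_map, Holds]
        constructor
        · rintro h _ ⟨a, ha, rfl⟩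
          exact ⟨a.2.trans i.2, h a ha⟩
        · intro h a ha
          exact (h _ ⟨a, ha, rfl⟩).2
      · rw [exists_mem_mulCat_getD (by simpa using h3)]
        exact forall₂_congr fun a ha => ih ⟨a, a.2.trans i.2⟩ b (by have := depthAt_lt ha; omega)
    · have hex : C.val T i = b ↔ ∃ a ∈ (C.gate i).preds, C.val T ⟨a.1, a.2.trans i.2⟩ = b := by
        have h3 : b = !decide ((C.gate i).kind = 2) := by
          cases b <;> simp_all
        rw [hv, h3]
        by_cases h : (C.gate i).kind = 2 <;> simp [h]
      rw [if_neg h2, hex, key]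

lemma mem_gateSet (K : List ℕ) {i : Fin C.size} : i ∈ C.gateSet K ↔ i.1 ∈ K := by
  simp [gateSet]

/-- The input gates of a list of gates. -/
def _root_.ParamCSP.inputs (G : Net) : List ℕ :=
  (List.range G.length).filter fun i => decide ((G.getD i (0, [])).1 = 0)

lemma mem_inputs {x : ℕ} : x ∈ inputs C.net ↔ ∃ h : x < C.size, C.gate ⟨x, h⟩ = .input := by
  have h1 : C.net.length = C.size := by simp [net]
  have h2 : ∀ {n : ℕ} (g : Gate n), g.kind = 0 ↔ g = .input := by
    intro n g
    cases g <;> simp [Gate.kind]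
  simp only [inputs, List.mem_filter, List.mem_range, h1, decide_eq_true_eq]
  constructor
  · rintro ⟨hx, h⟩
    rw [net_getD ⟨x, hx⟩, h2] at h
    exact ⟨hx, h⟩
  · rintro ⟨hx, h⟩
    refine ⟨hx, ?_⟩
    rw [net_getD ⟨x, hx⟩, h2]
    exact h

theorem hasWeightedSat_iff {d k : ℕ} (hd : C.depth < d) (hw : C.weft ≤ 1) :
    C.HasWeightedSat k ↔ ∃ L : List ℕ, L.Nodup ∧ L.length = k ∧ L ⊆ inputs C.net ∧
      ∃ e ∈ certs d C.net C.out true, ∀ c ∈ e, ev d C.net L c.1 = c.2 := by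
  have key : ∀ L, C.val (C.gateSet L) C.out = true ↔
      ∃ e ∈ certs d C.net C.out true, ∀ c ∈ e, ev d C.net L c.1 = c.2 := by
    intro L
    rw [val_iff_certs d _ _ _ hd]
    refine exists_congr fun e => and_congr_right fun he => forall₂_congr fun c hc => ?_
    obtain ⟨h, h1, h2⟩ := certs_wf d _ _ hd hw e he c hc
    rw [show ev d C.net L c.1 = _ from ev_net d L ⟨c.1, h⟩ h2]
    exact ⟨fun ⟨_, h⟩ => h, fun h' => ⟨h, h'⟩⟩
  constructor
  · rintro ⟨T, hT, hk, hval⟩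
    have hset : C.gateSet (T.toList.map fun i => i.1) = T := by
      ext i
      rw [mem_gateSet]
      simp only [List.mem_map, Finset.mem_toList]
      exact ⟨fun ⟨j, hj, h⟩ => Fin.ext h ▸ hj, fun h => ⟨i, h, rfl⟩⟩
    refine ⟨T.toList.map fun i => i.1, T.nodup_toList.map Fin.val_injective, by simpa using hk,
      ?_, (key _).1 (by rw [hset]; exact hval)⟩
    intro x hx
    obtain ⟨i, hi, rfl⟩ := List.mem_map.1 hx
    exact mem_inputs.2 ⟨i.2, hT i (Finset.mem_toList.1 hi)⟩
  · rintro ⟨L, hL, hk, hX, h⟩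
    refine ⟨C.gateSet L, fun i hi => ?_, ?_, (key L).2 h⟩
    · exact (mem_inputs.1 (hX (mem_gateSet L |>.1 hi))).2
    · rw [← hk, ← List.toFinset_card_of_nodup hL, ← Finset.card_map Fin.valEmbedding]
      congr 1
      ext x
      simp only [Finset.mem_map, mem_gateSet, Fin.valEmbedding_apply, List.mem_toFinset]
      constructor
      · rintro ⟨i, hi, rfl⟩
        exact hi
      · intro hx
        exact ⟨⟨x, (mem_inputs.1 (hX hx)).1⟩, hx, rfl⟩

end Circuit

@[fun_prop]
theorem Poly.inputs {γ : Type} [Enc γ] {G : γ → Net} (hG : Poly G) : Poly fun c => inputs (G c) := by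
  unfold ParamCSP.inputs
  fun_prop

/-! ## Fixed-parameter computations -/

lemma computable_add {f g : ℕ → ℕ} (hf : Computable f) (hg : Computable g) :
    Computable fun n => f n + g n := Primrec.nat_add.to_comp.comp hf hg

lemma computable_mul {f g : ℕ → ℕ} (hf : Computable f) (hg : Computable g) :
    Computable fun n => f n * g n := Primrec.nat_mul.to_comp.comp hf hg

lemma computable_pow {f : ℕ → ℕ} (hf : Computable f) (c : ℕ) : Computable fun n => f n ^ c :=
  (Primrec₂.unpaired'.1 Nat.Primrec.pow).to_comp.comp hf (Computable.const c)

/-- Sums of initial values. Monotonicity is needed because the new parameter is only bounded by a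
function of the old one. -/
lemma exists_computable_monotone {f : ℕ → ℕ} (hf : Computable f) :
    ∃ F : ℕ → ℕ, Computable F ∧ Monotone F ∧ ∀ n, f n ≤ F n := by
  refine ⟨fun n => Nat.rec (f 0) (fun m y => y + f (m + 1)) n, ?_, ?_, ?_⟩
  · refine Computable.nat_rec (f := fun n : ℕ => n) (g := fun _ => f 0)
      (h := fun _ (p : ℕ × ℕ) => p.2 + f (p.1 + 1)) Computable.id (Computable.const _) ?_
    exact Primrec.nat_add.to_comp.comp (Computable.snd.comp Computable.snd)
      (hf.comp (Computable.succ.comp (Computable.fst.comp Computable.snd)))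
  · exact monotone_nat_of_le_succ fun n => Nat.le_add_right _ _
  · rintro (_ | n)
    · exact le_rfl
    · exact Nat.le_add_left _ _

namespace FptComputable
variable {ι : Type} {κ : ι → ℕ}

theorem comp {inp mid out : ι → Data} (h : FptComputable inp κ mid) (h' : FptComputable mid κ out) :
    FptComputable inp κ out := by
  obtain ⟨p, f, c, hf, hp⟩ := h
  obtain ⟨q, g, d, hg, hq⟩ := h'
  refine ⟨.seq p q, fun n => f n + g n * f n ^ d + 1, c + c * d + 1,
    computable_add (computable_add hf (computable_mul hg (computable_pow hf d)))
      (Computable.const 1), fun i => ?_⟩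
  obtain ⟨s, hs, hs'⟩ := hp i
  obtain ⟨t, ht, ht'⟩ := hq i
  refine ⟨_, ?_, .seq hs' ht'⟩
  set n := (inp i).size
  have hn : 1 ≤ n := Data.one_le_size _
  have h1 : n ^ c ≤ n ^ (c + c * d + 1) := Nat.pow_le_pow_right hn (by omega)
  have h2 : (n ^ c) ^ d ≤ n ^ (c + c * d + 1) := by
    rw [← pow_mul]
    exact Nat.pow_le_pow_right hn (by omega)
  have h3 : n ≤ n ^ (c + c * d + 1) := Nat.le_self_pow (by omega) n
  have h4 : (mid i).size ^ d ≤ f (κ i) ^ d * (n ^ c) ^ d := by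
    rw [← mul_pow]
    exact Nat.pow_le_pow_left (hs'.size_le.trans hs) d
  calc s + t + n ≤ f (κ i) * n ^ (c + c * d + 1) +
        g (κ i) * (f (κ i) ^ d * n ^ (c + c * d + 1)) + n ^ (c + c * d + 1) := by
        refine add_le_add (add_le_add (hs.trans (Nat.mul_le_mul_left _ h1)) (ht.trans ?_)) h3
        exact Nat.mul_le_mul_left _ (h4.trans (Nat.mul_le_mul_left _ h2))
    _ = _ := by ring

theorem pair {inp a b : ι → Data} (h : FptComputable inp κ a) (h' : FptComputable inp κ b) :
    FptComputable inp κ fun i => .cons (a i) (b i) := by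
  obtain ⟨p, f, c, hf, hp⟩ := h
  obtain ⟨q, g, d, hg, hq⟩ := h'
  refine ⟨.pair p q, fun n => f n + g n + 1, c + d + 1,
    computable_add (computable_add hf hg) (Computable.const 1), fun i => ?_⟩
  obtain ⟨s, hs, hs'⟩ := hp i
  obtain ⟨t, ht, ht'⟩ := hq i
  refine ⟨_, ?_, .pair hs' ht'⟩
  set n := (inp i).size
  have hn : 1 ≤ n := Data.one_le_size _
  have h1 : n ^ c ≤ n ^ (c + d + 1) := Nat.pow_le_pow_right hn (by omega)
  have h2 : n ^ d ≤ n ^ (c + d + 1) := Nat.pow_le_pow_right hn (by omega)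
  have h3 : n ≤ n ^ (c + d + 1) := Nat.le_self_pow (by omega) n
  calc s + t + n ≤ f (κ i) * n ^ (c + d + 1) + g (κ i) * n ^ (c + d + 1) + n ^ (c + d + 1) :=
        add_le_add (add_le_add (hs.trans (Nat.mul_le_mul_left _ h1))
          (ht.trans (Nat.mul_le_mul_left _ h2))) h3
    _ = _ := by ring

theorem of_poly {α β : Type} [Enc α] [Enc β] {g : α → β} (hg : Poly g) (a : ι → α) :
    FptComputable (fun i => enc (a i)) κ fun i => enc (g (a i)) := by
  obtain ⟨p, P, hp⟩ := hg
  obtain ⟨c, hc⟩ := exists_eval_le_mul_pow P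
  refine ⟨p, fun _ => c, c, Computable.const c, fun i => ?_⟩
  obtain ⟨t, ht, ht'⟩ := hp (a i)
  exact ⟨t, ht.trans (hc _ (one_le_esize _)), ht'⟩

theorem comp_poly {α β : Type} [Enc α] [Enc β] {inp : ι → Data} {a : ι → α}
    (h : FptComputable inp κ fun i => enc (a i)) {g : α → β} (hg : Poly g) :
    FptComputable inp κ fun i => enc (g (a i)) := h.comp (of_poly hg a)

theorem reindex {ι' : Type} {inp out : ι → Data} (h : FptComputable inp κ out) (φ : ι' → ι) :
    FptComputable (fun i => inp (φ i)) (fun i => κ (φ i)) fun i => out (φ i) := by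
  obtain ⟨p, f, c, hf, hp⟩ := h
  exact ⟨p, f, c, hf, fun i => hp (φ i)⟩

theorem congr {inp inp' out out' : ι → Data} (h : FptComputable inp κ out)
    (hi : ∀ i, inp' i = inp i) (ho : ∀ i, out' i = out i) : FptComputable inp' κ out' := by
  obtain rfl : inp' = inp := funext hi
  obtain rfl : out' = out := funext ho
  exact h

/-- Recomputing the instance next to an answer to it. -/
theorem with_answer {α : Type} [Enc α] {y : List Bool × ℕ → α}
    (hy : FptComputable encInput (fun x => x.2) fun x => enc (y x)) (φ : ι → List Bool × ℕ)
    (a : ι → List Bool) : FptComputable (fun i => .cons (encInput (φ i)) (enc (a i)))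
      (fun i => (φ i).2) fun i => enc (y (φ i), a i) := by
  refine pair ?_ ?_
  · exact (of_poly (g := fun z : Data × List Bool => z.1) (by fun_prop)
      fun i => (encInput (φ i), a i)).comp (hy.reindex φ)
  · exact of_poly (g := fun z : Data × List Bool => z.2) (by fun_prop)
      fun i => (encInput (φ i), a i)

/-- Computations that depend on the parameter only. -/
theorem of_param {α : Type} [Enc α] {g : ℕ → α} {p : Prog} {f : ℕ → ℕ} (hf : Computable f)
    (hp : ∀ k, ∃ t, t ≤ f k ∧ Run p (enc k) (enc (g k)) t) {G : ℕ → ℕ} (hG : Computable G)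
    {k : ι → ℕ} (hk : ∀ i, k i ≤ G (κ i)) :
    FptComputable (fun i => enc (k i)) κ fun i => enc (g (k i)) := by
  obtain ⟨F, hF, hmono, hle⟩ := exists_computable_monotone hf
  refine ⟨p, fun n => F (G n), 0, hF.comp hG, fun i => ?_⟩
  obtain ⟨t, ht, ht'⟩ := hp (k i)
  refine ⟨t, ?_, ht'⟩
  rw [pow_zero, mul_one]
  exact ht.trans ((hle _).trans (hmono (hk i)))

end FptComputable

/-- Iterating a polynomial-time function takes a number of steps that is bounded by a computable
function of the input. -/
theorem exists_run_iterate {σ τ : Type} [Enc σ] [Enc τ] {h : σ → σ} (hh : Poly h) {s : ℕ → σ}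
    (hs : Poly s) {o : σ → τ} (ho : Poly o) :
    ∃ (p : Prog) (f : ℕ → ℕ), Computable f ∧
      ∀ k, ∃ t, t ≤ f k ∧ Run p (enc k) (enc (o (h^[k] (s k)))) t := by
  -- A list of `k` leaves is carried along as a counter, one leaf being removed in each round.
  have hc : Poly fun x : List Data × σ => !decide (x.1 = []) := by fun_prop
  have hF : Poly fun x : List Data × σ => (x.1.tail, h x.2) := by fun_prop
  have hst : Poly fun k : ℕ => (List.replicate k Data.nil, s k) := by fun_prop
  have ho' : Poly fun x : List Data × σ => o x.2 := by fun_prop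
  set F := fun x : List Data × σ => (x.1.tail, h x.2) with hFdef
  obtain ⟨B, hB⟩ := hF.output_size
  obtain ⟨b, hb⟩ := exists_eval_le_mul_pow B
  obtain ⟨p, P, hp⟩ := hc
  obtain ⟨q, Q, hq⟩ := hF
  obtain ⟨r, R, hr⟩ := hst
  obtain ⟨u, U, hu⟩ := ho'
  obtain ⟨cP, hP⟩ := exists_eval_le_mul_pow P
  obtain ⟨cQ, hQ⟩ := exists_eval_le_mul_pow Q
  obtain ⟨cR, hR⟩ := exists_eval_le_mul_pow R
  obtain ⟨cU, hU⟩ := exists_eval_le_mul_pow U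
  -- `v` bounds the size of a state after one round. The summand `m` makes its iterates increase, so
  -- `M k = v^[k] (m₀ k)` bounds all states of the run.
  let v : ℕ → ℕ := fun m => m + b * m ^ b
  have hvmono : Monotone v := fun m m' hm => by
    dsimp only [v]
    gcongr
  let n : ℕ → ℕ := fun k => 2 * k + 1
  let m₀ : ℕ → ℕ := fun k => cR * n k ^ cR
  let M : ℕ → ℕ := fun k => v^[k] (m₀ k)
  let T : ℕ → ℕ := fun k => (k + 1) * (cP * M k ^ cP + cQ * M k ^ cQ + M k)
  have hcm : ∀ (c : ℕ) {f : ℕ → ℕ}, Computable f → Computable fun k => c * f k ^ c :=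
    fun c f hf => computable_mul (Computable.const c) (computable_pow hf c)
  have hn : Computable n := computable_add (computable_mul (Computable.const 2) Computable.id)
    (Computable.const 1)
  have hv : Primrec v := Primrec.nat_add.comp Primrec.id (Primrec.nat_mul.comp (Primrec.const b)
    ((Primrec₂.unpaired'.1 Nat.Primrec.pow).comp Primrec.id (Primrec.const b)))
  have hM : Computable M := by
    have h0 : Primrec₂ fun (k m : ℕ) => v^[k] m :=
      Primrec.nat_iterate Primrec.fst Primrec.snd (hv.comp Primrec.snd).to₂
    exact h0.to_comp.comp Computable.id (hcm cR hn)
  have hT : Computable T := computable_mul Computable.succ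
    (computable_add (computable_add (hcm cP hM) (hcm cQ hM)) hM)
  refine ⟨.seq r (.seq (.loop p q) u), fun k => m₀ k + (T k + cU * M k ^ cU + M k) + n k,
    computable_add (computable_add (hcm cR hn) (computable_add (computable_add hT (hcm cU hM)) hM)) hn,
    fun k => ?_⟩
  obtain ⟨t₀, ht₀, hr₀⟩ := hr k
  have hsz : esize k = n k := Poly.esize_nat k
  have ht₀' : t₀ ≤ m₀ k := by
    refine ht₀.trans ((hR _ (one_le_esize _)).trans ?_)
    rw [hsz]
  have hiter : ∀ j, F^[j] (List.replicate k Data.nil, s k) =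
      (List.replicate (k - j) Data.nil, h^[j] (s k)) := by
    intro j
    induction j with
    | zero => rfl
    | succ j ih =>
      rw [Function.iterate_succ_apply', ih, Function.iterate_succ_apply', hFdef]
      simp [Nat.sub_sub]
  have hsize : ∀ j, esize (F^[j] (List.replicate k Data.nil, s k)) ≤ v^[j] (m₀ k) := by
    intro j
    induction j with
    | zero => exact hr₀.size_le.trans ht₀'
    | succ j ih =>
      rw [Function.iterate_succ_apply', Function.iterate_succ_apply']
      refine ((hB _).trans (hb _ (one_le_esize _))).trans (le_trans ?_ (hvmono ih))
      exact Nat.le_add_left _ _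
  have hsize' : ∀ j ≤ k, esize (F^[j] (List.replicate k Data.nil, s k)) ≤ M k := by
    intro j hj
    refine (hsize j).trans ?_
    exact Function.monotone_iterate_of_id_le (fun m => Nat.le_add_right m _) hj (m₀ k)
  obtain ⟨t₁, ht₁, hr₁⟩ := Poly.run_loop_iterate hp hq (M k) k (List.replicate k Data.nil, s k)
    (fun j hj => by rw [hiter]; simpa using by omega) (by rw [hiter]; simp) hsize'
  rw [hiter] at hr₁
  obtain ⟨t₂, ht₂, hr₂⟩ := hu (List.replicate (k - k) Data.nil, h^[k] (s k))
  have hle := hsize' k le_rfl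
  rw [hiter] at hle
  have hM1 : 1 ≤ M k := (one_le_esize _).trans hle
  refine ⟨_, ?_, .seq hr₀ (.seq hr₁ hr₂)⟩
  have e1 : t₁ ≤ T k := by
    refine ht₁.trans (Nat.mul_le_mul_left _ ?_)
    exact Nat.add_le_add_right (add_le_add (hP _ hM1) (hQ _ hM1)) _
  have e2 : t₂ ≤ cU * M k ^ cU := (ht₂.trans (eval_nat_mono U hle)).trans (hU _ hM1)
  have e3 : (enc (List.replicate k Data.nil, s k)).size ≤ M k := hsize' 0 (Nat.zero_le _)
  have e4 : (enc k).size = n k := hsz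
  rw [e4]
  exact add_le_add (add_le_add ht₀' (add_le_add (add_le_add e1 e2) e3)) le_rfl

/-- Prefixing one more letter to all words is polynomial in the current list, and `k` such rounds
produce the words of length `k`. -/
theorem exists_run_words (q : ℕ) : ∃ (p : Prog) (f : ℕ → ℕ), Computable f ∧
    ∀ k, ∃ t, t ≤ f k ∧ Run p (enc k) (enc (words (choices k q) k)) t := by
  have hh : Poly fun x : List (ℕ × ℕ) × List (List (ℕ × ℕ)) =>
      (x.1, x.1.flatMap fun a => x.2.map fun w => a :: w) := by fun_prop
  have hs : Poly fun k : ℕ => (choices k q, [([] : List (ℕ × ℕ))]) := by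
    unfold choices
    fun_prop
  obtain ⟨p, f, hf, hp⟩ := exists_run_iterate hh hs
    (o := fun x : List (ℕ × ℕ) × List (List (ℕ × ℕ)) => x.2) (by fun_prop)
  refine ⟨p, f, hf, fun k => ?_⟩
  have : ∀ (A : List (ℕ × ℕ)) (n : ℕ), (fun x : List (ℕ × ℕ) × List (List (ℕ × ℕ)) =>
      (x.1, x.1.flatMap fun a => x.2.map fun w => a :: w))^[n] (A, [[]]) = (A, words A n) := by
    intro A n
    induction n with
    | zero => rfl
    | succ n ih => rw [Function.iterate_succ_apply', ih]; rfl
  have h := hp k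
  rw [this] at h
  exact h

lemma length_words {α : Type} (A : List α) (n : ℕ) : (words A n).length = A.length ^ n := by
  induction n with
  | zero => rfl
  | succ n ih =>
    simp [words, List.length_flatMap, ih, pow_succ, mul_comm]

lemma length_slots (k q : ℕ) : (slots k q).length = (k + 1) ^ q := by
  simp [slots, length_words]

/-! ## The reduction -/

/-- The views for an encoded circuit, a weight, and the list of all sequences of choices. -/
def viewsOf (d : ℕ) (y : Data × ℕ × List (List (ℕ × ℕ))) : List View :=
  views d (2 ^ d) (decodeNet y.1) (certs d (decodeNet y.1) (toNat y.1.tail) true)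
    (inputs (decodeNet y.1)) y.2.1 y.2.2

@[fun_prop]
theorem Poly.viewsOf (d : ℕ) {γ : Type} [Enc γ] {y : γ → Data × ℕ × List (List (ℕ × ℕ))}
    (hy : Poly y) : Poly fun c => viewsOf d (y c) := by
  unfold ParamCSP.viewsOf
  fun_prop

@[fun_prop]
theorem Poly.slots (q : ℕ) {γ : Type} [Enc γ] {k : γ → ℕ} (hk : Poly k) :
    Poly fun c => slots (k c) q := by
  unfold ParamCSP.slots
  fun_prop

theorem hasWeightedSat_iff_views {C : Circuit} {d k : ℕ} (hd : C.depth < d) (hw : C.weft ≤ 1) :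
    C.HasWeightedSat k ↔ ∃ S : Finset (Fin (viewsOf d (C.enc, k,
        words (choices k (2 ^ d)) k)).length),
      (∀ i ∈ S, ∀ j ∈ S, i ≠ j → (viewsOf d (C.enc, k, words (choices k (2 ^ d)) k))[i].conflict
        (viewsOf d (C.enc, k, words (choices k (2 ^ d)) k))[j] = false) ∧
        (slots k (2 ^ d)).length ≤ S.card := by
  have hV : viewsOf d (C.enc, k, words (choices k (2 ^ d)) k) =
      views d (2 ^ d) C.net (certs d C.net C.out true) (inputs C.net) k
        (words (choices k (2 ^ d)) k) := by
    have hout : toNat C.enc.tail = C.out := toNat_ofNat _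
    simp only [viewsOf, decodeNet_enc, hout]
  have hins : ∀ e ∈ certs d C.net C.out true, ∀ c ∈ e, (ins d C.net c.1).length ≤ 2 ^ d := by
    intro e he c hc
    obtain ⟨h, h1, -⟩ := Circuit.certs_wf d _ _ hd hw e he c hc
    exact Circuit.length_ins d ⟨c.1, h⟩ h1
  rw [Circuit.hasWeightedSat_iff hd hw]
  constructor
  · rintro ⟨L, hL, hk, hX, e, he, hev⟩
    obtain ⟨S, hS, hN⟩ := exists_independent Nat.one_le_two_pow hins hL hk hX he hev hV
    exact ⟨S, hS, hN.ge⟩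
  · rintro ⟨S, hS, hN⟩
    exact exists_solution Nat.one_le_two_pow hins hV S hS hN

lemma ReducesToSearch.of_restrict {L : ParamLanguage} {Q : ParamSearchProblem} {D : Q.Inst → Prop}
    (h : ReducesToSearch L (Q.restrict D)) : ReducesToSearch L Q := by
  obtain ⟨F, g, h1, h2, h3, h4, h5⟩ := h
  exact ⟨fun x => (F x).1, g, h1, h2, h3, h4, h5⟩

/-- The auxiliary object `y` joins the circuit and its weight with the enumerated search sequences.
Views, clauses and the final test are polynomial in `y`, and the parameter is the number of slots.
-/
theorem reducesToSearch_simple {L : ParamLanguage} (hL : InW 1 L) :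
    ReducesToSearch L ((improveMaxCSP twoSAT).restrict fun J => J.csp.IsSimple) := by
  obtain ⟨d₀, F, g, hF, hg, h⟩ := hL
  -- `ev` and `certs` with argument `d` treat gates of depth strictly below `d`.
  set d := d₀ + 1 with hd
  let y : List Bool × ℕ → Data × ℕ × List (List (ℕ × ℕ)) := fun x =>
    ((F x).1.enc, (F x).2, words (choices (F x).2 (2 ^ d)) (F x).2)
  have hy : FptComputable encInput (fun x => x.2) fun x => enc (y x) := by
    have h1 : FptComputable encInput (fun x => x.2) fun x => enc ((F x).1.enc, (F x).2) := hF
    obtain ⟨p, f, hf, hp⟩ := exists_run_words (2 ^ d)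
    -- The enumeration costs time depending on the weight only, and the weight is at most `g x.2`.
    have h2 : FptComputable encInput (fun x => x.2)
        fun x => enc (words (choices (F x).2 (2 ^ d)) (F x).2) :=
      (h1.comp_poly (g := fun z => z.2) (by fun_prop)).comp
        (FptComputable.of_param (g := fun k => words (choices k (2 ^ d)) k) hf hp hg
          fun x => (h x).2.2.1)
    exact (h1.comp_poly (g := fun z => z.1) (by fun_prop)).pair
      ((h1.comp_poly (g := fun z => z.2) (by fun_prop)).pair h2)
  let N : List Bool × ℕ → ℕ := fun x => (slots (F x).2 (2 ^ d)).length
  refine ⟨fun x => ⟨viewInst (viewsOf d (y x)) (N x), instOf_isSimple _ _ _ _ (nodup_clauses _)⟩,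
    fun n => (g n + 1) ^ 2 ^ d, ?_, ?_, ?_, ?_, ?_⟩
  · have h1 := hy.comp_poly (g := fun y : Data × ℕ × List (List (ℕ × ℕ)) =>
      ((viewsOf d y).length, (clauses (viewsOf d y)).map (fun c => clauseCode c),
        (slots y.2.1 (2 ^ d)).length)) (by fun_prop)
    convert h1 using 2 with x
    exact instOf_enc _ _ (clauses_lt _) _
  · exact computable_pow (computable_add hg (Computable.const 1)) _
  · intro x
    change (slots (F x).2 (2 ^ d)).length ≤ _
    rw [length_slots]
    exact Nat.pow_le_pow_left (Nat.add_le_add_right (h x).2.2.1 1) _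
  · exact fun x => exists_correct _
  -- The decision procedure recomputes `y` from the input and applies the counting test to the
  -- answer.
  · have h1 := (FptComputable.with_answer hy
      (fun i : (x : List Bool × ℕ) × {α : Fin (viewsOf d (y x)).length → Bool //
        (improveMaxCSP twoSAT).Correct (viewInst (viewsOf d (y x)) (N x)) α} => i.1)
      (fun i => List.ofFn i.2.1)).comp_poly
        (g := fun z : (Data × ℕ × List (List (ℕ × ℕ))) × List Bool =>
          test (clauses (viewsOf d z.1)) (slots z.1.2.1 (2 ^ d)).length z.2) (by fun_prop)
    refine h1.congr (fun i => congrArg (Data.cons _) ?_) fun i => congrArg Data.ofBool ?_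
    · change Data.ofList (List.ofFn _) = Data.ofList ((List.ofFn _).map _)
      rw [List.map_ofFn]
      rfl
    · obtain ⟨x, α, hα⟩ := i
      obtain ⟨hw, hdep, -, hiff⟩ := h x
      rw [Bool.eq_iff_iff]
      refine (@decide_eq_true_iff _ (_)).trans (hiff.trans ?_)
      rw [hasWeightedSat_iff_views (d := d) (by omega) hw]
      exact (test_iff hα).symm

end ParamCSP

theorem mainTheorem7 :
    ParamCSP.IsW1Hard (ParamCSP.improveMaxCSP ParamCSP.twoSAT) ∧
    ParamCSP.IsW1Hard ((ParamCSP.improveMaxCSP ParamCSP.twoSAT).restrict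
      fun J => J.csp.IsSimple) :=
  ⟨fun _ hL => (ParamCSP.reducesToSearch_simple hL).of_restrict,
    fun _ hL => ParamCSP.reducesToSearch_simple hL⟩
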